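/- **Setting.** Let $O$ be an observation with law $Q$ on $\mathcal O$, and let $X=X(O)\in\mathcal X$ be its covariates. Let $A\in\mathbb R^{J\times K}$ be a known matrix of full row rank $J$, and let $b:\mathcal X\to\mathbb R^J$ and $c:\mathcal X\to\mathbb R^K$ be bounded measurable functions. Put $\mathcal P(x)=\{p\in\mathbb R^K: p\ge 0,\ Ap=b(x)\}$. Assume that $\mathcal P(x)$ is bounded for every $x$, and that there is an $\varepsilon>0$ such that every $\mathcal P(x)$ contains a point all of whose coordinates are at least $\varepsilon$. Fix $\eta>0$. For $\beta\in\mathbb R^J$, $\gamma\in\mathbb R^K$ let $p_L^\eta(\beta,\gamma)$ be the minimizer of $\langle\gamma,p\rangle+\frac1\eta\sum_{k}p_k(\log p_k-1)$ over $\{p\ge0: Ap=\beta\}$ (set to $0$ if this set is empty), and let $\nabla_bp_L^\eta$, $\nabla_cp_L^\eta$ be its Jacobians in $\beta$ and $\gamma$. Write $p_L^\eta(x)=p_L^\eta(b(x),c(x))$, and define the entropic lower bound $\theta_L^\eta=\mathbb E\langle c(X),p_L^\eta(X)\rangle$. **De-biasing functions.** For each $j\le J$ let $\varphi^{(b)}_j(O;\bar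 b_j)$ be a de-biasing function: $\mathbb E[\varphi_j^{(b)}(O;b_j)\mid X]=0$, $\mathbb E[\varphi_j^{(b)}(O;b_j)^2]<\infty$, and for every bounded measurable $\bar b_j:\mathcal X\to\mathbb R$, $\varphi_j^{(b)}(O;\bar b_j)$ is integrable and $\mathbb E[\bar b_j(X)+\varphi_j^{(b)}(O;\bar b_j)\mid X]=b_j(X)$ almost surely. Likewise let $\varphi^{(c)}_k(O;\bar c_k)$, $k\le K$, be de-biasing functions for the $c_k$. Write $\varphi^{(b)}(O)=(\varphi^{(b)}_j(O;b_j))_j$ and $\varphi^{(c)}(O)=(\varphi^{(c)}_k(O;c_k))_k$. **Estimates.** Let $O_1,O_2,\dots$ be iid with law $Q$, and $X_i=X(O_i)$. For each $n$ let $\hat b,\hat c,\hat\varphi^{(b)},\hat\varphi^{(c)}$ be (jointly measurable) random functions that are computed from a training sample independent of $(O_1,\dots,O_n)$. Assume that for all $j,k$, as $n\to\infty$, $$\sup_x|\hat b_j(x)-b_j(x)|,\quad \sup_x|\hat c_k(x)-c_k(x)|,\quad \sup_o|\hat\varphi^{(b)}_j(o)-\varphi^{(b)}_j(o)|,\quad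 \sup_o|\hat\varphi^{(c)}_k(o)-\varphi^{(c)}_k(o)|$$ are $o_p(1)$, and that there is a deterministic rate $r_n$ such that, with $\mathbb E$ over a fresh observation $O$ and the training sample held fixed, $$\bigl|\mathbb E\langle f(X),\hat b(X)+\hat\varphi^{(b)}(O)-b(X)\rangle\bigr|\le C\sup_x\|f(x)\|_2\,r_n,\qquad \bigl|\mathbb E\langle g(X),\hat c(X)+\hat\varphi^{(c)}(O)-c(X)\rangle\bigr|\le C\sup_x\|g(x)\|_2\,r_n$$ for all bounded measurable $f:\mathcal X\to\mathbb R^J$, $g:\mathcal X\to\mathbb R^K$ simultaneously, up to an event of arbitrarily small probability over the training sample (for every $\delta>0$ there is a $C$ such that, for all large $n$, each bound holds for all $f$, respectively all $g$, with probability at least $1-\delta$). **Estimator and variance.** With $\hat p_L^\eta(x)=p_L^\eta(\hat b(x),\hat c(x))$, and $\nabla_b\hat p_L^\eta(x)$, $\nabla_c\hat p_L^\eta(x)$ the Jacobians at $(\hat b(x),\hat c(x))$, let $$\hat\theta_L^\eta=\frac1n\sum_{i=1}^n\Bigl(\langle\hat c(X_i)+\hat\varphi^{(c)}(O_i),\hat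 p_L^\eta(X_i)\rangle+\langle\hat c(X_i),\nabla_b\hat p_L^\eta(X_i)\hat\varphi^{(b)}(O_i)+\nabla_c\hat p_L^\eta(X_i)\hat\varphi^{(c)}(O_i)\rangle\Bigr),$$ $$V_L^\eta=\operatorname{Var}\Bigl(\langle c(X)+\varphi^{(c)}(O),p_L^\eta(X)\rangle+\langle c(X),\nabla_bp_L^\eta(X)\varphi^{(b)}(O)+\nabla_cp_L^\eta(X)\varphi^{(c)}(O)\rangle\Bigr),$$ where $\nabla_bp_L^\eta(X)$, $\nabla_cp_L^\eta(X)$ are the Jacobians at $(b(X),c(X))$, and assume $V_L^\eta>0$. **Claim.** Write $\|\hat b-b\|_2^2=\sum_j\mathbb E[(\hat b_j(X)-b_j(X))^2]$ and $\|\hat c-c\|_2^2=\sum_k\mathbb E[(\hat c_k(X)-c_k(X))^2]$, the expectation being over a fresh $X$ with the training sample held fixed. If $\|\hat b-b\|_2=o_p(n^{-1/4})$, $\|\hat c-c\|_2=o_p(n^{-1/4})$ and $r_n=o(n^{-1/2})$, then $$\frac{\sqrt n\,(\hat\theta_L^\eta-\theta_L^\eta)}{\sqrt{V_L^\eta}}\Rightarrow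 N(0,1).$$ -/

import Mathlib

open MeasureTheory ProbabilityTheory Filter Topology
open scoped ENNReal RealInnerProductSpace

namespace CondLP

/-- Euclidean space `ℝᵈ`. -/
abbrev E (d : ℕ) : Type := EuclideanSpace ℝ (Fin d)

section Program

variable {J K : ℕ}

/-- The feasible set `{p ∈ ℝ^K_+ : A p = b}`. -/
def feasibleSet (A : Matrix (Fin J) (Fin K) ℝ) (b : E J) : Set (E K) :=
  {p | (∀ k, 0 ≤ p k) ∧ ∀ j, ∑ k, A j k * p k = b j}

/-- The objective `⟨c, p⟩ + η⁻¹ ∑ₖ pₖ (log pₖ - 1)` of the entropic minimization problem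
(with `0 log 0 = 0`). -/
noncomputable def entropicObjective (η : ℝ) (c p : E K) : ℝ :=
  ⟪c, p⟫ + (1 / η) * ∑ k, p k * (Real.log (p k) - 1)

/-- The set of minimizers of the entropic objective over the feasible set. -/
def entropicArgmin (A : Matrix (Fin J) (Fin K) ℝ) (η : ℝ) (b : E J) (c : E K) : Set (E K) :=
  {p | p ∈ feasibleSet A b ∧
    ∀ q ∈ feasibleSet A b, entropicObjective η c p ≤ entropicObjective η c q}

open Classical in
/-- The entropic solution `p_L^η(b, c)`: the minimizer of the entropic problem with constraint
vector `b` and objective vector `c` (by convention `0` if there is none). -/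
noncomputable def entropicSol (A : Matrix (Fin J) (Fin K) ℝ) (η : ℝ) (b : E J) (c : E K) : E K :=
  if h : (entropicArgmin A η b c).Nonempty then h.some else 0

/-- The Jacobian `∇_b p_L^η(b, c)`. -/
noncomputable def jacB (A : Matrix (Fin J) (Fin K) ℝ) (η : ℝ) (b : E J) (c : E K) :
    E J →L[ℝ] E K :=
  fderiv ℝ (fun b' => entropicSol A η b' c) b

/-- The Jacobian `∇_c p_L^η(b, c)`. -/
noncomputable def jacC (A : Matrix (Fin J) (Fin K) ℝ) (η : ℝ) (b : E J) (c : E K) :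
    E K →L[ℝ] E K :=
  fderiv ℝ (fun c' => entropicSol A η b c') c

/-- `⟨c + φc, p⟩ + ⟨c, ∇_b p φb + ∇_c p φc⟩` with `p = p_L^η(b, c)`: the summand of the de-biased
entropic estimator, for values `b, c` of the constraint and objective vectors and values
`φb, φc` of the de-biasing functions. -/
noncomputable def entropicTerm (A : Matrix (Fin J) (Fin K) ℝ) (η : ℝ) (b : E J) (c : E K)
    (φb : E J) (φc : E K) : ℝ :=
  ⟪c + φc, entropicSol A η b c⟫ + ⟪c, jacB A η b c φb + jacC A η b c φc⟫

end Program

section Statistics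

variable {Ω 𝒳 𝒪 : Type*} [MeasurableSpace Ω] [MeasurableSpace 𝒳] [MeasurableSpace 𝒪]

/-- The entropic lower bound `θ_L^η = E⟨c(X), p_L^η(b(X), c(X))⟩`. -/
noncomputable def entropicBound {J K : ℕ} (A : Matrix (Fin J) (Fin K) ℝ) (η : ℝ) (Q : Measure 𝒪)
    (X : 𝒪 → 𝒳) (b : 𝒳 → E J) (c : 𝒳 → E K) : ℝ :=
  ∫ o, ⟪c (X o), entropicSol A η (b (X o)) (c (X o))⟫ ∂Q

/-- The average of the entropic terms over the `n` observations `o₀, …, oₙ₋₁`, formed with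
constraint, objective and de-biasing functions `b, c, φb, φc`. -/
noncomputable def entropicAverage {J K : ℕ} (A : Matrix (Fin J) (Fin K) ℝ) (η : ℝ)
    (X : 𝒪 → 𝒳) (b : 𝒳 → E J) (c : 𝒳 → E K) (φb : 𝒪 → E J) (φc : 𝒪 → E K)
    (n : ℕ) (o : ℕ → 𝒪) : ℝ :=
  (1 / (n : ℝ)) * ∑ i ∈ Finset.range n,
    entropicTerm A η (b (X (o i))) (c (X (o i))) (φb (o i)) (φc (o i))

/-- `φ` is a de-biasing function for the scalar function `g` of the covariates, under the law `Q`
of an observation `O`: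
`E[φ(O; g) | X] = 0`, `E[φ(O; g)²] < ∞`, and `E[g'(X) + φ(O; g') | X] = g(X)` for every bounded
(measurable) function `g'`. -/
def IsDebiasing (Q : Measure 𝒪) (X : 𝒪 → 𝒳) (φ : (𝒳 → ℝ) → 𝒪 → ℝ) (g : 𝒳 → ℝ) : Prop :=
  MemLp (φ g) 2 Q ∧
  Q[φ g | MeasurableSpace.comap X inferInstance] =ᵐ[Q] 0 ∧
  ∀ g' : 𝒳 → ℝ, Measurable g' → (∃ M : ℝ, ∀ x, |g' x| ≤ M) →
    Integrable (φ g') Q ∧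
    Q[fun o => g' (X o) + φ g' o | MeasurableSpace.comap X inferInstance] =ᵐ[Q] fun o => g (X o)

/-- The vector `φ(O; g) = (φ₁(O; g₁), …, φ_d(O; g_d))` for a vector-valued function `g`. -/
noncomputable def debiasVec {d : ℕ} (φ : Fin d → (𝒳 → ℝ) → 𝒪 → ℝ) (g : 𝒳 → E d) (o : 𝒪) : E d :=
  WithLp.toLp 2 fun j => φ j (fun x => g x j) o

/-- `Zₙ = o_p(aₙ)` for nonnegative (possibly infinite) random quantities `Zₙ`. The measure `P` is
evaluated as an outer measure, so that no measurability of suprema is needed. -/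
def IsLittleOp (P : Measure Ω) (Z : ℕ → Ω → ℝ≥0∞) (a : ℕ → ℝ) : Prop :=
  ∀ ε : ℝ, 0 < ε → Tendsto (fun n => P {ω | ENNReal.ofReal (ε * a n) < Z n ω}) atTop (𝓝 0)

/-- `|E⟨f(X), ĝ(X) + φ̂(O) - g(X)⟩| ≤ sup ‖f‖₂ · R` for all bounded (measurable) `f`, the
expectation being over a fresh observation `O`, with the estimates `ĝ`, `φ̂` held fixed. -/
def DebiasedBound {d : ℕ} (Q : Measure 𝒪) (X : 𝒪 → 𝒳) (g ghat : 𝒳 → E d) (φhat : 𝒪 → E d)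
    (R : ℝ) : Prop :=
  ∀ f : 𝒳 → E d, Measurable f → ∀ M : ℝ, (∀ x, ‖f x‖ ≤ M) →
    |∫ o, ⟪f (X o), ghat (X o) + φhat o - g (X o)⟫ ∂Q| ≤ M * R

/-- The conditions on the estimates `ĝₙ` of a vector-valued function `g` and the estimates `φ̂ₙ` of
its de-biasing function `φ`: sup-norm consistency of every coordinate, and the
rate `rₙ` for de-biased linear functionals. The estimates at stage `n` are functions of the
training sample `Wₙ`; the rate bound holds with a constant, uniformly in `f`, up to an event of
arbitrarily small probability over the training sample. -/
def EstimationRates {d : ℕ} {𝒲 : ℕ → Type*} (P : Measure Ω) (Q : Measure 𝒪) (X : 𝒪 → 𝒳)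
    (W : ∀ n, Ω → 𝒲 n) (g : 𝒳 → E d) (φ : 𝒪 → E d)
    (ghat : ∀ n, 𝒲 n → 𝒳 → E d) (φhat : ∀ n, 𝒲 n → 𝒪 → E d) (r : ℕ → ℝ) : Prop :=
  (∀ j, IsLittleOp P (fun n ω => ⨆ x, ‖ghat n (W n ω) x j - g x j‖ₑ) (fun _ => 1)) ∧
  (∀ j, IsLittleOp P (fun n ω => ⨆ o, ‖φhat n (W n ω) o j - φ o j‖ₑ) (fun _ => 1)) ∧
  ∀ δ : ℝ, 0 < δ → ∃ C : ℝ, ∀ᶠ n in atTop,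
    P {ω | ¬ DebiasedBound Q X g (ghat n (W n ω)) (φhat n (W n ω)) (C * r n)} ≤ ENNReal.ofReal δ

end Statistics

end CondLP

/-! Put `s(β, γ) = ⟨γ, p(β, γ)⟩`, with `p` the entropic solution. By the product rule the summand of
the estimator is the one-step expression `s(ẑ) + Ds(ẑ) φ̂` at `ẑ = (b̂(X), ĉ(X))`
(`entropicTerm_eq`). At the true functions it is `ψ = s(z) + Ds(z) φ`. Its mean is the entropic
bound, since `φ` is conditionally centred given `X` and `Ds(z)` is a bounded function of `X`. The
centred and scaled average of `ψ` obeys the classical central limit theorem, so by Slutsky it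
remains to show that `n^(-1/2) ∑ D(Oᵢ)` tends to `0` in probability, where `D` is the estimated
summand minus `ψ`.

With the training sample held fixed, the `D(Oᵢ)` are iid, and Chebyshev asks for two things
(`tendstoInMeasure_inv_sqrt_mul_sum`). First, `∫ D²` is small: this follows from sup-norm
consistency and local Lipschitz bounds on `s` and `Ds`. Second, `√n |∫ D|` is small: expanding
around `ẑ`, the mean of `D` is a second-order Taylor remainder, of the order of the squared `L²`
errors, plus the mean of `Ds(ẑ)(ẑ + φ̂ - z)`, which the de-biased rate controls with the two partial
gradients as test functions (`abs_integral_plugin_sub_le`).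

The analytic input is smoothness of `p` with uniform constants. Stationarity says that `log p + ηγ`
lies in the orthogonal complement `M` of the kernel of the constraints, so `p = exp(μ - ηγ)` with `μ
∈ M`, where `μ` is fixed by the projection of `p` onto `M`. The map `μ ↦ P_M exp(μ - ηγ)` is
injective with invertible derivative, so the inverse function theorem applies
(`contDiffAt_entropicSol`). The uniform Slater point gives one radius of smoothness for all `x`, and
compactness gives uniform derivative bounds.

Estimates may leave the region of smoothness on a rare event, yet measurability of the summand is
needed everywhere. This is why the solution is also studied on faces and at constraint vectors
without a strictly positive feasible point. -/

namespace CondLP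

/-! ### Inverting the projected exponential -/

section ExpProjection

variable {ι : Type*}

/-- The coordinatewise exponential. -/
noncomputable def expVec (x : EuclideanSpace ℝ ι) : EuclideanSpace ℝ ι :=
  WithLp.toLp 2 fun i => Real.exp (x i)

@[simp] lemma expVec_apply (x : EuclideanSpace ℝ ι) (i : ι) : expVec x i = Real.exp (x i) := rfl

variable [Fintype ι]

lemma euclideanNorm_le_sum_abs (x : EuclideanSpace ℝ ι) : ‖x‖ ≤ ∑ i, |x i| := by
  rw [EuclideanSpace.norm_eq]
  refine Real.sqrt_le_iff.2 ⟨Finset.sum_nonneg fun i _ => abs_nonneg _, ?_⟩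
  exact Finset.sum_sq_le_sq_sum_of_nonneg fun i _ => abs_nonneg _

lemma contDiff_expVec : ContDiff ℝ ⊤ (expVec : EuclideanSpace ℝ ι → EuclideanSpace ℝ ι) := by
  rw [contDiff_euclidean]
  intro i
  simp only [expVec_apply]
  fun_prop

lemma fderiv_expVec_apply (x v : EuclideanSpace ℝ ι) (i : ι) :
    fderiv ℝ expVec x v i = Real.exp (x i) * v i := by
  have h : HasFDerivAt expVec (fderiv ℝ expVec x) x :=
    (contDiff_expVec.differentiable (by simp)).differentiableAt.hasFDerivAt
  have h1 := (EuclideanSpace.proj i : EuclideanSpace ℝ ι →L[ℝ] ℝ).hasFDerivAt.comp x h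
  have h2 : HasFDerivAt (fun y : EuclideanSpace ℝ ι => Real.exp (y i))
      (Real.exp (x i) • (EuclideanSpace.proj i : EuclideanSpace ℝ ι →L[ℝ] ℝ)) x :=
    (EuclideanSpace.proj i : EuclideanSpace ℝ ι →L[ℝ] ℝ).hasFDerivAt.exp
  have h3 := congrArg (fun L => L v) (h1.unique h2)
  simpa using h3

variable (M : Submodule ℝ (EuclideanSpace ℝ ι))

/-- The map `(μ, c) ↦ (P_M exp(μ - c), c)`, with `P_M` the orthogonal projection onto `M`. -/
noncomputable def expProj (z : M × EuclideanSpace ℝ ι) : M × EuclideanSpace ℝ ι :=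
  (M.orthogonalProjectionOnto (expVec ((z.1 : EuclideanSpace ℝ ι) - z.2)), z.2)

lemma contDiff_expProj : ContDiff ℝ ⊤ (expProj M) := by
  refine ContDiff.prodMk ?_ contDiff_snd
  refine M.orthogonalProjectionOnto.contDiff.comp (contDiff_expVec.comp ?_)
  exact (M.subtypeL.contDiff.comp contDiff_fst).sub contDiff_snd

/-- Strict monotonicity of `exp`: equal projections make `exp(μ - c) - exp(ν - c)` orthogonal to `μ
- ν ∈ M`, but this inner product is a sum of nonnegative terms that vanish only where the
coordinates agree. -/
lemma expProj_injective : Function.Injective (expProj M) := by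
  rintro ⟨μ, c⟩ ⟨ν, d⟩ h
  obtain ⟨h1, rfl⟩ : _ ∧ c = d := by simpa [expProj] using h
  have h2 : ⟪expVec ((μ : EuclideanSpace ℝ ι) - c) - expVec ((ν : EuclideanSpace ℝ ι) - c),
      ((μ - ν : M) : EuclideanSpace ℝ ι)⟫ = 0 := by
    rw [← Submodule.inner_orthogonalProjectionOnto_eq_of_mem_right, map_sub, h1, sub_self,
      inner_zero_left]
  have h3 : ∀ i, 0 ≤ (μ.1 i - ν.1 i) * (Real.exp (μ.1 i - c i) - Real.exp (ν.1 i - c i)) := by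
    intro i
    rcases le_total (μ.1 i) (ν.1 i) with hle | hle
    · exact mul_nonneg_of_nonpos_of_nonpos (by linarith)
        (sub_nonpos.2 (Real.exp_le_exp.2 (by linarith)))
    · exact mul_nonneg (by linarith) (sub_nonneg.2 (Real.exp_le_exp.2 (by linarith)))
  have h4 : ∑ i, (μ.1 i - ν.1 i) * (Real.exp (μ.1 i - c i) - Real.exp (ν.1 i - c i)) = 0 := by
    simpa [PiLp.inner_apply] using h2
  rw [Finset.sum_eq_zero_iff_of_nonneg fun i _ => h3 i] at h4
  refine Prod.ext (Subtype.ext (PiLp.ext fun i => ?_)) rfl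
  rcases mul_eq_zero.1 (h4 i (Finset.mem_univ i)) with h5 | h5
  · exact sub_eq_zero.1 h5
  · simpa using Real.exp_injective (sub_eq_zero.1 h5)

/-- The linearized monotonicity argument: the derivative of the coordinatewise exponential is a
positive diagonal matrix, so its compression to `M` has trivial kernel. -/
lemma fderiv_expProj_injective (z : M × EuclideanSpace ℝ ι) :
    Function.Injective (fderiv ℝ (expProj M) z) := by
  rw [injective_iff_map_eq_zero]
  rintro ⟨μ, c⟩ h
  have hz : HasFDerivAt (fun z : M × EuclideanSpace ℝ ι => (z.1 : EuclideanSpace ℝ ι) - z.2)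
      (M.subtypeL ∘L ContinuousLinearMap.fst ℝ _ _ - ContinuousLinearMap.snd ℝ _ _) z :=
    (M.subtypeL ∘L ContinuousLinearMap.fst ℝ _ _ - ContinuousLinearMap.snd ℝ _ _).hasFDerivAt
  have he := ((contDiff_expVec (ι := ι)).differentiable (by simp)
    |>.differentiableAt (x := (z.1 : EuclideanSpace ℝ ι) - z.2)).hasFDerivAt
  have hd := (M.orthogonalProjectionOnto.hasFDerivAt.comp z (he.comp z hz)).prodMk
    (hasFDerivAt_snd (𝕜 := ℝ) (p := z))
  change HasFDerivAt (expProj M) _ z at hd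
  rw [hd.fderiv] at h
  obtain ⟨h1, rfl⟩ : _ ∧ c = 0 := by simpa using h
  have h2 : ⟪fderiv ℝ expVec ((z.1 : EuclideanSpace ℝ ι) - z.2) μ, (μ : EuclideanSpace ℝ ι)⟫
      = 0 := by
    have h1' : M.orthogonalProjectionOnto
        (fderiv ℝ expVec ((z.1 : EuclideanSpace ℝ ι) - z.2) μ) = 0 := by simpa using h1
    rw [← Submodule.inner_orthogonalProjectionOnto_eq_of_mem_right, h1', inner_zero_left]
  simp only [PiLp.inner_apply, fderiv_expVec_apply, RCLike.inner_apply, conj_trivial] at h2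
  rw [Finset.sum_eq_zero_iff_of_nonneg fun i _ => by
    rw [mul_left_comm]
    exact mul_nonneg (Real.exp_pos _).le (mul_self_nonneg _)] at h2
  refine Prod.ext (Subtype.ext (PiLp.ext fun i => ?_)) rfl
  simpa using h2 i (Finset.mem_univ i)

lemma exists_hasFDerivAt_expProj_equiv (z : M × EuclideanSpace ℝ ι) :
    ∃ D : (M × EuclideanSpace ℝ ι) ≃L[ℝ] (M × EuclideanSpace ℝ ι),
      HasFDerivAt (expProj M) (D : (M × EuclideanSpace ℝ ι) →L[ℝ] (M × EuclideanSpace ℝ ι)) z := by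
  refine ⟨(LinearEquiv.ofInjectiveEndo (fderiv ℝ (expProj M) z).toLinearMap
    (fderiv_expProj_injective M z)).toContinuousLinearEquiv, ?_⟩
  have h := ((contDiff_expProj M).differentiable (by simp)).differentiableAt (x := z) |>.hasFDerivAt
  exact h

/-- The inverse function theorem gives a smooth local inverse; global injectivity forces the
set-theoretic inverse to agree with it near `y`. -/
lemma contDiffAt_invFun_expProj {y : M × EuclideanSpace ℝ ι} (hy : y ∈ Set.range (expProj M)) :
    ContDiffAt ℝ ⊤ (Function.invFun (expProj M)) y := by
  obtain ⟨z, rfl⟩ := hy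
  obtain ⟨D, hD⟩ := exists_hasFDerivAt_expProj_equiv M z
  have hc := (contDiff_expProj M).contDiffAt (x := z)
  refine (hc.to_localInverse hD (by simp)).congr_of_eventuallyEq ?_
  have hs := hc.hasStrictFDerivAt' hD (by simp)
  filter_upwards [hs.eventually_right_inverse] with y hy
  conv_lhs => rw [← hy]
  exact Function.leftInverse_invFun (expProj_injective M) _

lemma exp_sub_mul_lower_bound {p : ℝ} (hp : 0 < p) (c : ℝ) :
    ∃ C : ℝ, ∀ t : ℝ, p * |t| - C ≤ Real.exp (t - c) - p * t := by
  refine ⟨|2 * p * (c + Real.log (2 * p) - 1)|, fun t => ?_⟩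
  -- The tangent line of `exp` with slope `2p`: after subtracting `p t`, slope `p` remains for
  -- positive `t`. For negative `t` the term `-p t` suffices alone.
  have h1 : 2 * p * (t - c - Real.log (2 * p) + 1) ≤ Real.exp (t - c) := by
    have h2 := Real.add_one_le_exp (t - c - Real.log (2 * p))
    rw [Real.exp_sub, Real.exp_log (by positivity), le_div_iff₀ (by positivity)] at h2
    linarith
  have h3 := le_abs_self (2 * p * (c + Real.log (2 * p) - 1))
  have h4 := abs_nonneg (2 * p * (c + Real.log (2 * p) - 1))
  have h5 := Real.exp_pos (t - c)
  rcases abs_cases t with ⟨ht, _⟩ | ⟨ht, _⟩ <;> rw [ht] <;> nlinarith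

/-- Existence of a dual optimum: `∑ (exp(μᵢ - cᵢ) - pᵢ μᵢ)` is coercive on `M` because `p` is
positive, and stationarity at its minimizer says that `exp(μ - c) - p` is orthogonal to `M`. -/
lemma orthogonalProjectionOnto_mem_range_expProj {p : EuclideanSpace ℝ ι} (hp : ∀ i, 0 < p i)
    (c : EuclideanSpace ℝ ι) :
    (M.orthogonalProjectionOnto p, c) ∈ Set.range (expProj M) := by
  let f : M → ℝ := fun μ => ∑ i, (Real.exp (μ.1 i - c i) - p i * μ.1 i)
  have hf : Continuous f := by fun_prop
  obtain ⟨κ, hκ, hκp⟩ : ∃ κ : ℝ, 0 < κ ∧ ∀ i, κ ≤ p i := by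
    rcases isEmpty_or_nonempty ι with h | h
    · exact ⟨1, one_pos, fun i => h.elim i⟩
    · obtain ⟨i, hi⟩ := Finite.exists_min fun i => p i
      exact ⟨p i, hp i, hi⟩
  choose C hC using fun i => exp_sub_mul_lower_bound (hp i) (c i)
  have hlow : ∀ μ : M, κ * ‖μ‖ - ∑ i, C i ≤ f μ := by
    intro μ
    have h1 : ‖μ‖ ≤ ∑ i, |μ.1 i| := euclideanNorm_le_sum_abs μ.1
    calc κ * ‖μ‖ - ∑ i, C i ≤ κ * (∑ i, |μ.1 i|) - ∑ i, C i := by gcongr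
      _ = ∑ i, (κ * |μ.1 i| - C i) := by rw [Finset.mul_sum, Finset.sum_sub_distrib]
      _ ≤ ∑ i, (p i * |μ.1 i| - C i) := by
        gcongr with i
        exact hκp i
      _ ≤ f μ := Finset.sum_le_sum fun i _ => hC i _
  have hlim : Tendsto f (cocompact M) atTop := by
    refine tendsto_atTop_mono hlow ?_
    refine tendsto_atTop_add_const_right _ _ ?_
    exact (tendsto_norm_cocompact_atTop (E := M)).const_mul_atTop hκ
  obtain ⟨μ, hμ⟩ := hf.exists_forall_le hlim
  refine ⟨(μ, c), Prod.ext ?_ rfl⟩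
  rw [expProj, ← sub_eq_zero, ← map_sub, Submodule.orthogonalProjectionOnto_eq_zero_iff]
  refine (Submodule.mem_orthogonal' _ _).2 fun m hm => ?_
  have hd : HasDerivAt (fun s : ℝ => f (μ + s • ⟨m, hm⟩))
      (∑ i, (Real.exp (μ.1 i - c i) * m i - p i * m i)) 0 := by
    refine HasDerivAt.fun_sum fun i _ => ?_
    have h0 : HasDerivAt (fun s : ℝ => μ.1 i + s * m i) (m i) 0 := by
      simpa using ((hasDerivAt_id (0 : ℝ)).mul_const (m i)).const_add (μ.1 i)
    have h1 := (h0.sub_const (c i)).exp.fun_sub (h0.const_mul (p i))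
    simpa using h1
  have hz := IsLocalMin.hasDerivAt_eq_zero
    (Eventually.of_forall fun s => by simpa using hμ (μ + s • ⟨m, hm⟩)) hd
  rw [← hz, PiLp.inner_apply]
  refine Finset.sum_congr rfl fun i _ => ?_
  simp
  ring

end ExpProjection

/-! ### The entropic program: uniqueness, optimality and smoothness of its solution -/

section EntropicProgram

variable {J K : ℕ}

/-- The linear map `p ↦ A p` on Euclidean spaces. -/
noncomputable def constraintMap (A : Matrix (Fin J) (Fin K) ℝ) : E K →L[ℝ] E J :=
  (Matrix.toEuclideanLin A).toContinuousLinearMap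

lemma constraintMap_apply (A : Matrix (Fin J) (Fin K) ℝ) (p : E K) (j : Fin J) :
    constraintMap A p j = ∑ k, A j k * p k := by
  simp [constraintMap, Matrix.toLpLin_apply, Matrix.mulVec, dotProduct]

lemma mem_feasibleSet_iff {A : Matrix (Fin J) (Fin K) ℝ} {b : E J} {p : E K} :
    p ∈ feasibleSet A b ↔ (∀ k, 0 ≤ p k) ∧ constraintMap A p = b := by
  refine and_congr_right fun _ => ⟨fun h => PiLp.ext fun j => ?_, fun h j => ?_⟩
  · rw [constraintMap_apply, h j]
  · rw [← constraintMap_apply, h]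

lemma constraintMap_surjective {A : Matrix (Fin J) (Fin K) ℝ} (hA : A.rank = J) :
    Function.Surjective (constraintMap A) := by
  have h1 : Function.Surjective A.mulVecLin := by
    rw [← LinearMap.range_eq_top]
    apply Submodule.eq_top_of_finrank_eq
    simpa [Matrix.rank] using hA
  intro b
  obtain ⟨p, hp⟩ := h1 b.ofLp
  refine ⟨WithLp.toLp 2 p, PiLp.ext fun j => ?_⟩
  rw [constraintMap_apply, ← hp]
  rfl

lemma convex_feasibleSet (A : Matrix (Fin J) (Fin K) ℝ) (b : E J) :
    Convex ℝ (feasibleSet A b) := by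
  intro p hp q hq s t hs ht hst
  rw [mem_feasibleSet_iff] at *
  refine ⟨fun k => add_nonneg (mul_nonneg hs (hp.1 k)) (mul_nonneg ht (hq.1 k)), ?_⟩
  rw [map_add, map_smul, map_smul, hp.2, hq.2, ← add_smul, hst, one_smul]

lemma entropicObjective_eq_sum (η : ℝ) (c p : E K) :
    entropicObjective η c p =
      ∑ k, (c k * p k + (1 / η) * (p k * Real.log (p k) - p k)) := by
  simp only [entropicObjective, PiLp.inner_apply, RCLike.inner_apply, conj_trivial,
    Finset.mul_sum, ← Finset.sum_add_distrib]
  exact Finset.sum_congr rfl fun k _ => by ring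

lemma continuous_entropicObjective (η : ℝ) :
    Continuous fun z : E K × E K => entropicObjective η z.1 z.2 := by
  simp only [entropicObjective_eq_sum]
  refine continuous_finsetSum _ fun k _ => ?_
  have h : Continuous fun z : E K × E K => z.2 k * Real.log (z.2 k) :=
    Real.continuous_mul_log.comp (by fun_prop)
  fun_prop

lemma entropicArgmin_subsingleton (A : Matrix (Fin J) (Fin K) ℝ) {η : ℝ} (hη : 0 < η) (b : E J)
    (c : E K) : (entropicArgmin A η b c).Subsingleton := by
  intro p hp q hq
  by_contra hne
  obtain ⟨k, hk⟩ : ∃ k, p k ≠ q k := by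
    by_contra! h
    exact hne (PiLp.ext h)
  let m : E K := (1 / 2 : ℝ) • p + (1 / 2 : ℝ) • q
  have hm : m ∈ feasibleSet A b :=
    convex_feasibleSet A b hp.1 hq.1 (by norm_num) (by norm_num) (by norm_num)
  have heq : entropicObjective η c p = entropicObjective η c q :=
    le_antisymm (hp.2 q hq.1) (hq.2 p hp.1)
  have hmk : ∀ i, m i = (1 / 2 : ℝ) * p i + (1 / 2 : ℝ) * q i := fun i => rfl
  have hconv : ∀ i, m i * Real.log (m i) ≤
      (1 / 2 : ℝ) * (p i * Real.log (p i)) + (1 / 2 : ℝ) * (q i * Real.log (q i)) := fun i => by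
    simpa [hmk] using Real.convexOn_mul_log.2 (Set.mem_Ici.2 (hp.1.1 i))
      (Set.mem_Ici.2 (hq.1.1 i)) (by norm_num : (0 : ℝ) ≤ 1 / 2) (by norm_num : (0 : ℝ) ≤ 1 / 2)
      (by norm_num)
  have hstrict : m k * Real.log (m k) <
      (1 / 2 : ℝ) * (p k * Real.log (p k)) + (1 / 2 : ℝ) * (q k * Real.log (q k)) := by
    simpa [hmk] using Real.strictConvexOn_mul_log.2 (Set.mem_Ici.2 (hp.1.1 k))
      (Set.mem_Ici.2 (hq.1.1 k)) hk (by norm_num : (0 : ℝ) < 1 / 2)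
      (by norm_num : (0 : ℝ) < 1 / 2) (by norm_num)
  have hη' : 0 < 1 / η := by positivity
  have hlt : entropicObjective η c m <
      (1 / 2 : ℝ) * entropicObjective η c p + (1 / 2 : ℝ) * entropicObjective η c q := by
    simp only [entropicObjective_eq_sum, Finset.mul_sum, ← Finset.sum_add_distrib]
    refine Finset.sum_lt_sum (fun i _ => ?_) ⟨k, Finset.mem_univ k, ?_⟩
    · have := mul_le_mul_of_nonneg_left (hconv i) hη'.le
      rw [hmk] at *
      linarith
    · have := mul_lt_mul_of_pos_left hstrict hη'
      rw [hmk] at *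
      linarith
  have := hp.2 m hm
  linarith

lemma entropicSol_eq_of_mem {A : Matrix (Fin J) (Fin K) ℝ} {η : ℝ} (hη : 0 < η) {b : E J}
    {c p : E K} (hp : p ∈ entropicArgmin A η b c) : entropicSol A η b c = p := by
  have h : (entropicArgmin A η b c).Nonempty := ⟨p, hp⟩
  rw [entropicSol, dif_pos h]
  exact entropicArgmin_subsingleton A hη b c h.some_mem hp

lemma entropicSol_eq_zero_of_feasibleSet_eq_empty {A : Matrix (Fin J) (Fin K) ℝ} {η : ℝ} {b : E J}
    (h : feasibleSet A b = ∅) (c : E K) : entropicSol A η b c = 0 := by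
  refine dif_neg ?_
  rintro ⟨p, hp, -⟩
  simp [h] at hp

/-- Sufficiency of first-order conditions by convexity: for `p > 0`, `q log q ≥ q log p + q - p`.
Coordinates where `p` vanishes must vanish for every competitor, since the entropy has no finite
slope there. -/
lemma mem_entropicArgmin_of_stationary {A : Matrix (Fin J) (Fin K) ℝ} {η : ℝ} (hη : 0 < η)
    {b : E J} {c p : E K} (hp : p ∈ feasibleSet A b)
    (hsupp : ∀ q ∈ feasibleSet A b, ∀ k, p k = 0 → q k = 0)
    (hstat : ∀ q ∈ feasibleSet A b, ∑ k, (η * c k + Real.log (p k)) * (q k - p k) = 0) :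
    p ∈ entropicArgmin A η b c := by
  refine ⟨hp, fun q hq => ?_⟩
  have hterm : ∀ k, (1 / η) * ((η * c k + Real.log (p k)) * (q k - p k)) ≤
      (c k * q k + (1 / η) * (q k * Real.log (q k) - q k)) -
        (c k * p k + (1 / η) * (p k * Real.log (p k) - p k)) := by
    intro k
    rcases (hp.1 k).eq_or_lt with h0 | h0
    · rw [← h0, hsupp q hq k h0.symm]
      simp
    · have hkl : q k * Real.log (p k) + q k - p k ≤ q k * Real.log (q k) := by
        rcases (hq.1 k).eq_or_lt with h1 | h1
        · rw [← h1]
          simpa using h0.le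
        · have h2 := Real.log_le_sub_one_of_pos (div_pos h0 h1)
          rw [Real.log_div h0.ne' h1.ne', le_sub_iff_add_le, le_div_iff₀ h1] at h2
          linarith
      have h3 : (1 / η) * ((q k * Real.log (p k) + q k - p k)) ≤
          (1 / η) * (q k * Real.log (q k)) :=
        mul_le_mul_of_nonneg_left hkl (by positivity)
      have h4 : (1 / η) * (η * c k * (q k - p k)) = c k * (q k - p k) := by
        field_simp
      linarith
  have hsum := Finset.sum_le_sum fun k (_ : k ∈ Finset.univ) => hterm k
  rw [← Finset.mul_sum, hstat q hq, mul_zero, Finset.sum_sub_distrib, ← entropicObjective_eq_sum,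
    ← entropicObjective_eq_sum] at hsum
  linarith

/-! ### Explicit solution on a face of the orthant -/

section Face

variable {ι : Type*}

/-- Extension by zero along an injection `e`. -/
noncomputable def extendVec (e : ι ↪ Fin K) : EuclideanSpace ℝ ι →ₗ[ℝ] E K where
  toFun x := WithLp.toLp 2 (Function.extend e x 0)
  map_add' x y := by
    ext k
    by_cases h : ∃ i, e i = k
    · obtain ⟨i, rfl⟩ := h
      simp [e.injective.extend_apply]
    · simp [Function.extend_apply' _ _ _ h]
  map_smul' r x := by
    ext k
    by_cases h : ∃ i, e i = k
    · obtain ⟨i, rfl⟩ := h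
      simp [e.injective.extend_apply]
    · simp [Function.extend_apply' _ _ _ h]

lemma extendVec_apply (e : ι ↪ Fin K) (x : EuclideanSpace ℝ ι) (i : ι) :
    extendVec e x (e i) = x i := by
  simp [extendVec, e.injective.extend_apply]

lemma extendVec_apply_of_notMem_range (e : ι ↪ Fin K) (x : EuclideanSpace ℝ ι) {k : Fin K}
    (hk : k ∉ Set.range e) : extendVec e x k = 0 := by
  simp [extendVec, Function.extend_apply' _ _ _ hk]

/-- Restriction of coordinates along `e`. -/
noncomputable def restrictVec (e : ι ↪ Fin K) : E K →ₗ[ℝ] EuclideanSpace ℝ ι where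
  toFun x := WithLp.toLp 2 fun i => x (e i)
  map_add' _ _ := rfl
  map_smul' _ _ := rfl

@[simp] lemma restrictVec_apply (e : ι ↪ Fin K) (x : E K) (i : ι) :
    restrictVec e x i = x (e i) := rfl

lemma extendVec_restrictVec (e : ι ↪ Fin K) {x : E K} (hx : ∀ k ∉ Set.range e, x k = 0) :
    extendVec e (restrictVec e x) = x := by
  refine PiLp.ext fun k => ?_
  by_cases hk : k ∈ Set.range e
  · obtain ⟨i, rfl⟩ := hk
    rw [extendVec_apply, restrictVec_apply]
  · rw [extendVec_apply_of_notMem_range e _ hk, hx k hk]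

variable [Fintype ι]

/-- The multiplier space of the face of the nonnegative orthant spanned by the coordinates in the
range of `e`. -/
noncomputable def multiplierSpace (A : Matrix (Fin J) (Fin K) ℝ) (e : ι ↪ Fin K) :
    Submodule ℝ (EuclideanSpace ℝ ι) :=
  (LinearMap.ker ((constraintMap A).toLinearMap ∘ₗ extendVec e))ᗮ

/-- The solution of the entropic program on a face, in terms of the projection `m` of a feasible
point onto the multiplier space and of `x = η c`. -/
noncomputable def faceSol (A : Matrix (Fin J) (Fin K) ℝ) (e : ι ↪ Fin K)
    (z : multiplierSpace A e × EuclideanSpace ℝ ι) : EuclideanSpace ℝ ι :=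
  expVec (((Function.invFun (expProj (multiplierSpace A e)) z).1 : EuclideanSpace ℝ ι) - z.2)

lemma contDiffAt_faceSol (A : Matrix (Fin J) (Fin K) ℝ) (e : ι ↪ Fin K)
    {z : multiplierSpace A e × EuclideanSpace ℝ ι}
    (hz : z ∈ Set.range (expProj (multiplierSpace A e))) : ContDiffAt ℝ ⊤ (faceSol A e) z := by
  refine contDiff_expVec.contDiffAt.comp z (ContDiffAt.sub ?_ contDiffAt_snd)
  exact (multiplierSpace A e).subtypeL.contDiff.contDiffAt.comp z
    (contDiffAt_fst.comp z (contDiffAt_invFun_expProj _ hz))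

/-- The vector `x = exp(μ - ηc)` with the same projection onto the multiplier space as `p₀` differs
from `p₀` by a kernel vector, hence is feasible. Moreover `log x + ηc = μ` is orthogonal to all
feasible directions, which is stationarity. -/
lemma entropicSol_eq_extendVec_faceSol {A : Matrix (Fin J) (Fin K) ℝ} {η : ℝ} (hη : 0 < η)
    {b : E J} (e : ι ↪ Fin K) {p₀ : E K} (hp₀ : p₀ ∈ feasibleSet A b) (hpos : ∀ i, 0 < p₀ (e i))
    (hface : ∀ q ∈ feasibleSet A b, ∀ k ∉ Set.range e, q k = 0) (c : E K) :
    entropicSol A η b c = extendVec e (faceSol A e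
      ((multiplierSpace A e).orthogonalProjectionOnto (restrictVec e p₀),
        η • restrictVec e c)) := by
  set M := multiplierSpace A e
  obtain ⟨⟨μ, c'⟩, hμ⟩ := orthogonalProjectionOnto_mem_range_expProj M
    (p := restrictVec e p₀) hpos (η • restrictVec e c)
  have hc' : c' = η • restrictVec e c := congrArg Prod.snd hμ
  have hproj := congrArg Prod.fst hμ
  have hinv : Function.invFun (expProj M) (M.orthogonalProjectionOnto (restrictVec e p₀),
      η • restrictVec e c) = (μ, c') := by
    rw [← hμ]
    exact Function.leftInverse_invFun (expProj_injective M) _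
  set x : EuclideanSpace ℝ ι := expVec ((μ : EuclideanSpace ℝ ι) - c') with hx
  have hsol : faceSol A e (M.orthogonalProjectionOnto (restrictVec e p₀),
      η • restrictVec e c) = x := by
    rw [faceSol, hinv, ← hc']
  rw [hsol]
  have hdiff : x - restrictVec e p₀ ∈
      LinearMap.ker ((constraintMap A).toLinearMap ∘ₗ extendVec e) := by
    rw [← Submodule.orthogonal_orthogonal
      (LinearMap.ker ((constraintMap A).toLinearMap ∘ₗ extendVec e))]
    change _ ∈ Mᗮ
    rw [← Submodule.orthogonalProjectionOnto_eq_zero_iff, map_sub, sub_eq_zero]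
    exact hproj
  have hext : ∀ q ∈ feasibleSet A b, extendVec e (restrictVec e q) = q :=
    fun q hq => extendVec_restrictVec e (hface q hq)
  have hfeas : extendVec e x ∈ feasibleSet A b := by
    rw [mem_feasibleSet_iff] at hp₀ ⊢
    constructor
    · intro k
      by_cases hk : k ∈ Set.range e
      · obtain ⟨i, rfl⟩ := hk
        rw [extendVec_apply]
        exact (Real.exp_pos _).le
      · rw [extendVec_apply_of_notMem_range e _ hk]
    · have h1 : constraintMap A (extendVec e (x - restrictVec e p₀)) = 0 := hdiff
      rw [map_sub, map_sub, hext p₀ (mem_feasibleSet_iff.2 hp₀), sub_eq_zero] at h1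
      rw [h1, hp₀.2]
  refine entropicSol_eq_of_mem hη (mem_entropicArgmin_of_stationary hη hfeas ?_ ?_)
  · intro q hq k hk
    by_cases hk' : k ∈ Set.range e
    · obtain ⟨i, rfl⟩ := hk'
      rw [extendVec_apply] at hk
      exact absurd hk (Real.exp_pos _).ne'
    · exact hface q hq k hk'
  · intro q hq
    have hker : restrictVec e q - x ∈
        LinearMap.ker ((constraintMap A).toLinearMap ∘ₗ extendVec e) := by
      change constraintMap A (extendVec e (restrictVec e q - x)) = 0
      rw [map_sub, map_sub, hext q hq, (mem_feasibleSet_iff.1 hq).2,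
        (mem_feasibleSet_iff.1 hfeas).2, sub_self]
    have horth : ⟪restrictVec e q - x, (μ : EuclideanSpace ℝ ι)⟫ = 0 :=
      (Submodule.mem_orthogonal _ _).1 μ.2 _ hker
    rw [PiLp.inner_apply] at horth
    rw [← horth]
    symm
    refine Fintype.sum_of_injective e e.injective _ _ (fun k hk => ?_) fun i => ?_
    · rw [hface q hq k hk, extendVec_apply_of_notMem_range e _ hk, sub_zero, mul_zero]
    · rw [extendVec_apply, hx, expVec_apply, Real.log_exp, hc']
      simp

end Face

/-- The midpoint of two feasible points is supported on the union of their supports, so a support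
maximal under inclusion contains all others. It spans the face on which the program has a strictly
positive feasible point. -/
lemma exists_mem_feasibleSet_maximal_support {A : Matrix (Fin J) (Fin K) ℝ} {b : E J}
    (h : (feasibleSet A b).Nonempty) :
    ∃ p ∈ feasibleSet A b, ∀ q ∈ feasibleSet A b, ∀ k, p k = 0 → q k = 0 := by
  classical
  let S : Set (Finset (Fin K)) :=
    (fun p : E K => Finset.univ.filter fun k => p k ≠ 0) '' feasibleSet A b
  obtain ⟨_, ⟨p, hp, rfl⟩, hmax⟩ := (Set.toFinite S).exists_maximal (h.image _)
  refine ⟨p, hp, fun q hq k hpk => ?_⟩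
  by_contra hqk
  let m : E K := (1 / 2 : ℝ) • p + (1 / 2 : ℝ) • q
  have hm : m ∈ feasibleSet A b :=
    convex_feasibleSet A b hp hq (by norm_num) (by norm_num) (by norm_num)
  have hmk : ∀ i, m i = (1 / 2 : ℝ) * p i + (1 / 2 : ℝ) * q i := fun i => rfl
  have hle : (Finset.univ.filter fun k => p k ≠ 0) ≤ Finset.univ.filter fun k => m k ≠ 0 := by
    intro i hi
    simp only [Finset.mem_filter, Finset.mem_univ, true_and] at hi ⊢
    have h1 := lt_of_le_of_ne (hp.1 i) hi.symm
    have h2 := hq.1 i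
    rw [hmk]
    positivity
  have hmem : k ∈ Finset.univ.filter fun k => m k ≠ 0 := by
    simpa only [Finset.mem_filter, Finset.mem_univ, true_and, hmk, hpk, mul_zero, zero_add, ne_eq,
      mul_eq_zero, one_div, inv_eq_zero, OfNat.ofNat_ne_zero, false_or] using hqk
  simpa [hpk] using hmax ⟨m, hm, rfl⟩ hle hmem

lemma differentiable_entropicSol_right (A : Matrix (Fin J) (Fin K) ℝ) {η : ℝ} (hη : 0 < η)
    (b : E J) : Differentiable ℝ fun c => entropicSol A η b c := by
  rcases (feasibleSet A b).eq_empty_or_nonempty with h | h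
  · simp only [entropicSol_eq_zero_of_feasibleSet_eq_empty h]
    exact differentiable_const _
  obtain ⟨p, hp, hmax⟩ := exists_mem_feasibleSet_maximal_support h
  let e : {k // 0 < p k} ↪ Fin K := Function.Embedding.subtype _
  have hrep := entropicSol_eq_extendVec_faceSol hη e hp (fun i => i.2) fun q hq k hk =>
    hmax q hq k (le_antisymm (by simpa [e] using hk) (hp.1 k))
  simp only [hrep]
  intro c
  have hmem := orthogonalProjectionOnto_mem_range_expProj (multiplierSpace A e)
    (p := restrictVec e p) (fun i => i.2) (η • restrictVec e c)
  have h1 : DifferentiableAt ℝ (faceSol A e)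
      ((multiplierSpace A e).orthogonalProjectionOnto (restrictVec e p), η • restrictVec e c) :=
    (contDiffAt_faceSol A e hmem).differentiableAt (by simp)
  have h2 : DifferentiableAt ℝ (fun c : E K =>
      ((multiplierSpace A e).orthogonalProjectionOnto (restrictVec e p),
        η • restrictVec e c)) c :=
    (differentiableAt_const _).prodMk
      ((restrictVec e).toContinuousLinearMap.differentiableAt.const_smul η)
  exact (extendVec e).toContinuousLinearMap.differentiableAt.comp c
    (DifferentiableAt.comp (g := faceSol A e) c h1 h2)

/-- The constraint vectors that admit a strictly positive feasible point. -/
def slaterSet (A : Matrix (Fin J) (Fin K) ℝ) : Set (E J) :=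
  constraintMap A '' {p | ∀ k, 0 < p k}

lemma isOpen_slaterSet {A : Matrix (Fin J) (Fin K) ℝ} (hA : A.rank = J) :
    IsOpen (slaterSet A) := by
  refine (constraintMap A).isOpenMap (constraintMap_surjective hA) _ ?_
  simp only [Set.ofPred_forall]
  exact isOpen_iInter_of_finite fun k => isOpen_lt continuous_const (by fun_prop)

lemma convex_slaterSet (A : Matrix (Fin J) (Fin K) ℝ) : Convex ℝ (slaterSet A) := by
  refine Convex.linear_image (f := (constraintMap A).toLinearMap) ?_
  refine convex_iff_forall_pos.2 fun p hp q hq s t hs ht _ k => ?_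
  exact add_pos (mul_pos hs (hp k)) (mul_pos ht (hq k))

lemma contDiffAt_entropicSol {A : Matrix (Fin J) (Fin K) ℝ} (hA : A.rank = J) {η : ℝ} (hη : 0 < η)
    {z : E J × E K} (hz : z.1 ∈ slaterSet A) :
    ContDiffAt ℝ ⊤ (fun z : E J × E K => entropicSol A η z.1 z.2) z := by
  let e : Fin K ↪ Fin K := Function.Embedding.refl _
  -- A linear section `R` of the constraints makes the projection of a feasible point a linear
  -- function of `b`: `R (A p) - p` lies in the kernel, so `R b` and any feasible `p` have the same
  -- projection.
  obtain ⟨R, hR⟩ := LinearMap.exists_rightInverse_of_surjective (constraintMap A).toLinearMap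
    (LinearMap.range_eq_top.2 (constraintMap_surjective hA))
  let L : E J →L[ℝ] multiplierSpace A e := (multiplierSpace A e).orthogonalProjectionOnto ∘L
    ((restrictVec e) ∘ₗ R).toContinuousLinearMap
  let N : E J × E K →L[ℝ] multiplierSpace A e × E K :=
    (L ∘L ContinuousLinearMap.fst ℝ _ _).prod (η • ContinuousLinearMap.snd ℝ _ _)
  have hres : ∀ p : E K, restrictVec e p = p := fun p => rfl
  have hext : ∀ p : E K, extendVec e p = p := fun p =>
    extendVec_restrictVec e (x := p) fun k hk => absurd ⟨k, rfl⟩ hk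
  have hL : ∀ p, L (constraintMap A p) = (multiplierSpace A e).orthogonalProjectionOnto p := by
    intro p
    change (multiplierSpace A e).orthogonalProjectionOnto (R (constraintMap A p)) = _
    rw [← sub_eq_zero, ← map_sub, Submodule.orthogonalProjectionOnto_eq_zero_iff, multiplierSpace,
      Submodule.orthogonal_orthogonal]
    change constraintMap A (extendVec e (R (constraintMap A p) - p)) = 0
    rw [hext, map_sub, sub_eq_zero]
    exact LinearMap.congr_fun hR (constraintMap A p)
  have hev : (fun z : E J × E K => entropicSol A η z.1 z.2) =ᶠ[𝓝 z]
      fun z => faceSol A e (N z) := by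
    filter_upwards [((isOpen_slaterSet hA).preimage continuous_fst).mem_nhds hz] with y hy
    obtain ⟨p, hp, hpy⟩ := hy
    have h1 := entropicSol_eq_extendVec_faceSol hη (b := y.1) e (p₀ := p)
      (mem_feasibleSet_iff.2 ⟨fun k => (hp k).le, hpy⟩) hp
      (fun q _ k hk => absurd ⟨k, rfl⟩ hk) y.2
    rw [h1, hext, hres, ← hL, hpy]
    rfl
  refine ContDiffAt.congr_of_eventuallyEq ?_ hev
  obtain ⟨p, hp, hpz⟩ := hz
  refine ContDiffAt.comp (g := faceSol A e) z (contDiffAt_faceSol A e ?_) N.contDiff.contDiffAt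
  have h2 := orthogonalProjectionOnto_mem_range_expProj (multiplierSpace A e) (p := p) hp (η • z.2)
  rw [← hL, hpz] at h2
  exact h2

end EntropicProgram

/-! ### Measurability of the solution and its Jacobians at all arguments -/

section EntropicMeasurability

variable {J K : ℕ}

lemma _root_.IsSigmaCompact.measurableSet {X : Type*} [TopologicalSpace X] [T2Space X]
    [MeasurableSpace X] [OpensMeasurableSpace X] {s : Set X} (hs : IsSigmaCompact s) :
    MeasurableSet s := by
  obtain ⟨C, hC, rfl⟩ := hs
  exact MeasurableSet.iUnion fun n => (hC n).measurableSet

lemma isClosed_setOf_mem_feasibleSet (A : Matrix (Fin J) (Fin K) ℝ) :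
    IsClosed {z : E J × E K | z.2 ∈ feasibleSet A z.1} := by
  have h : {z : E J × E K | z.2 ∈ feasibleSet A z.1} =
      (⋂ k, {z | 0 ≤ z.2 k}) ∩ {z | constraintMap A z.2 = z.1} := by
    ext z
    simp [mem_feasibleSet_iff]
  rw [h]
  refine IsClosed.inter (isClosed_iInter fun k => ?_) ?_
  · exact isClosed_le continuous_const (by fun_prop)
  · exact isClosed_eq (by fun_prop) (by fun_prop)

lemma measurableSet_graph_entropicArgmin (A : Matrix (Fin J) (Fin K) ℝ) (η : ℝ) :
    MeasurableSet {z : (E J × E K) × E K | z.2 ∈ entropicArgmin A η z.1.1 z.1.2} := by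
  let F : Set ((E J × E K) × E K) := {z | z.2 ∈ feasibleSet A z.1.1}
  -- Pairs in which a feasible competitor improves by at least `1/(n+1)`. The slack makes the set
  -- closed, hence σ-compact, so that its projection is again σ-compact and therefore Borel.
  let B : ℕ → Set (((E J × E K) × E K) × E K) := fun n =>
    {w | w.2 ∈ feasibleSet A w.1.1.1 ∧
      entropicObjective η w.1.1.2 w.2 + 1 / ((n : ℝ) + 1) ≤ entropicObjective η w.1.1.2 w.1.2}
  have hobj := continuous_entropicObjective (K := K) η
  have hB : ∀ n, MeasurableSet (Prod.fst '' B n) := by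
    intro n
    have hcl : IsClosed (B n) := by
      refine IsClosed.and ?_ (isClosed_le ?_ ?_)
      · exact (isClosed_setOf_mem_feasibleSet A).preimage
          (f := fun w : ((E J × E K) × E K) × E K => (w.1.1.1, w.2)) (by fun_prop)
      · exact (hobj.comp (f := fun w : ((E J × E K) × E K) × E K => (w.1.1.2, w.2))
          (by fun_prop)).add continuous_const
      · exact hobj.comp (f := fun w : ((E J × E K) × E K) × E K => (w.1.1.2, w.1.2))
          (by fun_prop)
    exact ((isSigmaCompact_univ.of_isClosed_subset hcl (Set.subset_univ _)).image continuous_fst).measurableSet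
  have hF : MeasurableSet F := ((isClosed_setOf_mem_feasibleSet A).preimage
    (f := fun w : (E J × E K) × E K => (w.1.1, w.2)) (by fun_prop)).measurableSet
  have hset : {z : (E J × E K) × E K | z.2 ∈ entropicArgmin A η z.1.1 z.1.2} =
      F \ ⋃ n, Prod.fst '' B n := by
    ext z
    simp only [Set.mem_ofPred_eq, entropicArgmin, Set.mem_sdiff, Set.mem_iUnion, not_exists, F]
    refine and_congr_right fun _ => ⟨?_, fun h q hq => ?_⟩
    · rintro h n ⟨w, ⟨hw1, hw2⟩, rfl⟩
      have h1 := h _ hw1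
      have h2 : 0 < 1 / ((n : ℝ) + 1) := by positivity
      linarith
    · by_contra! hlt
      obtain ⟨n, hn⟩ := exists_nat_one_div_lt (sub_pos.2 hlt)
      exact h n ⟨(z, q), ⟨hq, by linarith⟩, rfl⟩
  rw [hset]
  exact hF.diff (MeasurableSet.iUnion hB)

/-- By uniqueness of minimizers the first projection is injective on the Borel graph of the argmin,
so by Lusin–Souslin it maps Borel subsets of the graph to Borel sets. -/
lemma measurable_entropicSol (A : Matrix (Fin J) (Fin K) ℝ) {η : ℝ} (hη : 0 < η) :
    Measurable fun z : E J × E K => entropicSol A η z.1 z.2 := by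
  set G := {z : (E J × E K) × E K | z.2 ∈ entropicArgmin A η z.1.1 z.1.2} with hGdef
  have hG : MeasurableSet G := measurableSet_graph_entropicArgmin A η
  have hinj : Set.InjOn (Prod.fst : (E J × E K) × E K → E J × E K) G := by
    rintro ⟨z, p⟩ hp ⟨_, q⟩ hq rfl
    exact Prod.ext rfl (entropicArgmin_subsingleton A hη z.1 z.2 hp hq)
  have himage : ∀ s : Set (E K), MeasurableSet s →
      MeasurableSet (Prod.fst '' (G ∩ Prod.snd ⁻¹' s)) := fun s hs =>
    (hG.inter (measurable_snd hs)).image_of_measurable_injOn measurable_fst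
      (hinj.mono Set.inter_subset_left)
  intro s hs
  have hset : (fun z : E J × E K => entropicSol A η z.1 z.2) ⁻¹' s =
      Prod.fst '' (G ∩ Prod.snd ⁻¹' s) ∪
        ((Prod.fst '' (G ∩ Prod.snd ⁻¹' Set.univ))ᶜ ∩ {_z | (0 : E K) ∈ s}) := by
    ext z
    by_cases h : (entropicArgmin A η z.1 z.2).Nonempty
    · obtain ⟨p, hp⟩ := h
      have h1 : z ∈ Prod.fst '' (G ∩ Prod.snd ⁻¹' Set.univ) := ⟨(z, p), ⟨hp, trivial⟩, rfl⟩
      simp only [Set.mem_preimage, entropicSol_eq_of_mem hη hp, Set.mem_union, Set.mem_inter_iff,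
        Set.mem_compl_iff, h1, not_true_eq_false, false_and, or_false]
      refine ⟨fun hps => ⟨(z, p), ⟨hp, hps⟩, rfl⟩, ?_⟩
      rintro ⟨⟨z', q⟩, ⟨hq, hqs⟩, rfl⟩
      rwa [entropicArgmin_subsingleton A hη _ _ hp hq]
    · have h0 : entropicSol A η z.1 z.2 = 0 := dif_neg h
      have h1 : ∀ t : Set (E K), z ∉ Prod.fst '' (G ∩ Prod.snd ⁻¹' t) := by
        rintro t ⟨⟨z', q⟩, ⟨hq, -⟩, rfl⟩
        exact h ⟨q, hq⟩
      simp only [Set.mem_preimage, h0, Set.mem_union, h1, Set.mem_inter_iff, Set.mem_compl_iff,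
        not_false_eq_true, true_and, false_or]
      rfl
  rw [hset]
  exact (himage s hs).union ((himage _ MeasurableSet.univ).compl.inter (MeasurableSet.const _))

lemma mem_closure_slaterSet {A : Matrix (Fin J) (Fin K) ℝ} {b : E J}
    (h : (feasibleSet A b).Nonempty) : b ∈ closure (slaterSet A) := by
  obtain ⟨p, hp⟩ := h
  rw [mem_feasibleSet_iff] at hp
  let u : E K := WithLp.toLp 2 fun _ => 1
  have hlim : Tendsto (fun n : ℕ => constraintMap A (p + (1 / ((n : ℝ) + 1)) • u)) atTop (𝓝 b) := by
    have h1 : Tendsto (fun n : ℕ => p + (1 / ((n : ℝ) + 1)) • u) atTop (𝓝 (p + (0 : ℝ) • u)) :=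
      (tendsto_one_div_add_atTop_nhds_zero_nat.smul_const u).const_add p
    have h2 := ((constraintMap A).continuous.tendsto _).comp h1
    rw [zero_smul, add_zero, hp.2] at h2
    exact h2
  refine mem_closure_of_tendsto hlim (Eventually.of_forall fun n => ⟨_, fun k => ?_, rfl⟩)
  have h1 : 0 < 1 / ((n : ℝ) + 1) := by positivity
  have h2 : (p + (1 / ((n : ℝ) + 1)) • u) k = p k + 1 / ((n : ℝ) + 1) := by simp [u]
  rw [h2]
  linarith [hp.1 k]

/-- A hyperplane separates `b` from the open convex Slater set; strictly beyond it the program is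
infeasible and the solution is `0` by convention. If a derivative exists at `b`, it vanishes on an
open half-space of directions, and these span. If none exists, `fderiv` is `0` by default. -/
lemma jacB_eq_zero_of_notMem_slaterSet {A : Matrix (Fin J) (Fin K) ℝ} (hA : A.rank = J) {η : ℝ}
    {b : E J} (hb : b ∉ slaterSet A) (c : E K) : jacB A η b c = 0 := by
  by_cases hd : DifferentiableAt ℝ (fun b' => entropicSol A η b' c) b
  swap
  · exact fderiv_zero_of_not_differentiableAt hd
  obtain ⟨f, hf⟩ := geometric_hahn_banach_open_point (convex_slaterSet A) (isOpen_slaterSet hA) hb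
  have hzero : ∀ b', f b < f b' → entropicSol A η b' c = 0 := by
    intro b' hb'
    refine entropicSol_eq_zero_of_feasibleSet_eq_empty ?_ c
    by_contra hne
    have h1 := mem_closure_slaterSet (Set.nonempty_iff_ne_empty.2 hne)
    have h2 : closure (slaterSet A) ⊆ {x | f x ≤ f b} :=
      closure_minimal (fun x hx => (hf x hx).le) (isClosed_le f.continuous continuous_const)
    exact absurd (h2 h1) (not_le.2 hb')
  obtain ⟨v₀, hv₀⟩ : ∃ v, 0 < f v := by
    let u : E K := WithLp.toLp 2 fun _ => 1
    refine ⟨b - constraintMap A u, ?_⟩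
    rw [map_sub]
    exact sub_pos.2 (hf _ ⟨u, fun k => by simp [u], rfl⟩)
  have hstep : ∀ v, 0 < f v → ∀ n : ℕ,
      entropicSol A η (b + ((n : ℝ) + 1)⁻¹ • v) c = 0 := by
    intro v hv n
    refine hzero _ ?_
    rw [map_add, map_smul, smul_eq_mul]
    have : 0 < ((n : ℝ) + 1)⁻¹ * f v := by positivity
    linarith
  have hinv : Tendsto (fun n : ℕ => ((n : ℝ) + 1)⁻¹) atTop (𝓝 0) := by
    simpa only [one_div] using tendsto_one_div_add_atTop_nhds_zero_nat (𝕜 := ℝ)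
  have hb0 : entropicSol A η b c = 0 := by
    have h1 : Tendsto (fun n : ℕ => b + ((n : ℝ) + 1)⁻¹ • v₀) atTop (𝓝 b) := by
      simpa using (hinv.smul_const v₀).const_add b
    have h2 := hd.continuousAt.tendsto.comp h1
    refine tendsto_nhds_unique h2 ?_
    simp only [Function.comp_def, hstep v₀ hv₀]
    exact tendsto_const_nhds
  have hpos : ∀ v, 0 < f v → jacB A η b c v = 0 := by
    intro v hv
    have h1 := hd.hasFDerivAt.lim_real v
    have h2 : Tendsto (fun n : ℕ => (n : ℝ) + 1) atTop atTop :=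
      tendsto_atTop_add_const_right _ _ tendsto_natCast_atTop_atTop
    refine tendsto_nhds_unique (h1.comp h2) ?_
    simp only [Function.comp_def, hstep v hv, hb0, sub_zero, smul_zero]
    exact tendsto_const_nhds
  ext1 w
  have h1 : 0 < f (w + ((|f w| + 1) / f v₀) • v₀) := by
    rw [map_add, map_smul, smul_eq_mul, div_mul_cancel₀ _ hv₀.ne']
    linarith [neg_abs_le (f w)]
  have h2 := hpos _ h1
  rw [map_add, map_smul, hpos v₀ hv₀, smul_zero, add_zero] at h2
  simpa using h2

lemma differentiableAt_entropicSol_left {A : Matrix (Fin J) (Fin K) ℝ} (hA : A.rank = J) {η : ℝ}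
    (hη : 0 < η) {b : E J} (hb : b ∈ slaterSet A) (c : E K) :
    DifferentiableAt ℝ (fun b' => entropicSol A η b' c) b :=
  DifferentiableAt.comp (g := fun z : E J × E K => entropicSol A η z.1 z.2) (f := fun b' => (b', c))
    b ((contDiffAt_entropicSol hA hη (z := (b, c)) hb).differentiableAt (by simp)) (by fun_prop)

lemma tendsto_natCast_add_one_atTop : Tendsto (fun n : ℕ => (n : ℝ) + 1) atTop atTop :=
  tendsto_atTop_add_const_right _ _ tendsto_natCast_atTop_atTop

lemma measurable_jacC_apply (A : Matrix (Fin J) (Fin K) ℝ) {η : ℝ} (hη : 0 < η) (v : E K) :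
    Measurable fun z : E J × E K => jacC A η z.1 z.2 v := by
  have hmeas := measurable_entropicSol A hη
  refine measurable_of_tendsto_metrizable (f := fun (n : ℕ) (z : E J × E K) =>
    ((n : ℝ) + 1) • (entropicSol A η z.1 (z.2 + ((n : ℝ) + 1)⁻¹ • v) -
      entropicSol A η z.1 z.2)) (fun n => ?_) (tendsto_pi_nhds.2 fun z => ?_)
  · exact ((hmeas.comp (g := fun z : E J × E K => entropicSol A η z.1 z.2)
      (f := fun z : E J × E K => (z.1, z.2 + ((n : ℝ) + 1)⁻¹ • v)) (by fun_prop)).sub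
        hmeas).const_smul ((n : ℝ) + 1)
  · exact ((differentiable_entropicSol_right A hη z.1 z.2).hasFDerivAt.lim_real v).comp
      tendsto_natCast_add_one_atTop

lemma measurable_jacB_apply {A : Matrix (Fin J) (Fin K) ℝ} (hA : A.rank = J) {η : ℝ}
    (hη : 0 < η) (v : E J) : Measurable fun z : E J × E K => jacB A η z.1 z.2 v := by
  have hmeas := measurable_entropicSol A hη
  -- Difference quotients converge on the Slater set; outside it they need not, but there the
  -- Jacobian is `0`, which the indicator supplies.
  refine measurable_of_tendsto_metrizable (f := fun (n : ℕ) => Set.indicator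
    (Prod.fst ⁻¹' slaterSet A) fun (z : E J × E K) =>
      ((n : ℝ) + 1) • (entropicSol A η (z.1 + ((n : ℝ) + 1)⁻¹ • v) z.2 -
        entropicSol A η z.1 z.2)) (fun n => ?_) (tendsto_pi_nhds.2 fun z => ?_)
  · refine Measurable.indicator ?_ (measurable_fst (isOpen_slaterSet hA).measurableSet)
    exact ((hmeas.comp (g := fun z : E J × E K => entropicSol A η z.1 z.2)
      (f := fun z : E J × E K => (z.1 + ((n : ℝ) + 1)⁻¹ • v, z.2)) (by fun_prop)).sub
        hmeas).const_smul ((n : ℝ) + 1)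
  · by_cases hz : z.1 ∈ slaterSet A
    · simp only [Set.indicator_of_mem (show z ∈ Prod.fst ⁻¹' slaterSet A from hz)]
      exact ((differentiableAt_entropicSol_left hA hη hz z.2).hasFDerivAt.lim_real v).comp
        tendsto_natCast_add_one_atTop
    · simp only [Set.indicator_of_notMem (show z ∉ Prod.fst ⁻¹' slaterSet A from hz),
        jacB_eq_zero_of_notMem_slaterSet hA hz, _root_.zero_apply]
      exact tendsto_const_nhds

lemma measurable_clm_apply_of_forall {α : Type*} [MeasurableSpace α] {d m : ℕ}
    {L : α → E d →L[ℝ] E m} {v : α → E d} (hL : ∀ w, Measurable fun a => L a w)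
    (hv : Measurable v) : Measurable fun a => L a (v a) := by
  have h : ∀ a, L a (v a) = ∑ i, v a i • L a (EuclideanSpace.single i 1) := by
    intro a
    conv_lhs => rw [← (EuclideanSpace.basisFun (Fin d) ℝ).sum_repr (v a), map_sum]
    simp
  simp only [h]
  refine Finset.measurable_fun_sum _ fun i _ => Measurable.fun_smul ?_ (hL _)
  exact (EuclideanSpace.proj i : E d →L[ℝ] ℝ).continuous.measurable.comp hv

lemma measurable_entropicTerm {A : Matrix (Fin J) (Fin K) ℝ} (hA : A.rank = J) {η : ℝ}
    (hη : 0 < η) : Measurable fun w : (E J × E K) × (E J × E K) =>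
      entropicTerm A η w.1.1 w.1.2 w.2.1 w.2.2 := by
  have h1 := (measurable_entropicSol A hη).comp
    (measurable_fst : Measurable (Prod.fst : (E J × E K) × (E J × E K) → _))
  have h2 : Measurable fun w : (E J × E K) × (E J × E K) => jacB A η w.1.1 w.1.2 w.2.1 :=
    measurable_clm_apply_of_forall (L := fun w : (E J × E K) × (E J × E K) => jacB A η w.1.1 w.1.2)
      (fun v => (measurable_jacB_apply hA hη v).comp measurable_fst) (by fun_prop)
  have h3 : Measurable fun w : (E J × E K) × (E J × E K) => jacC A η w.1.1 w.1.2 w.2.2 :=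
    measurable_clm_apply_of_forall (L := fun w : (E J × E K) × (E J × E K) => jacC A η w.1.1 w.1.2)
      (fun v => (measurable_jacC_apply A hη v).comp measurable_fst) (by fun_prop)
  have h4 : Measurable fun w : (E J × E K) × (E J × E K) => w.1.2 + w.2.2 := by fun_prop
  have h5 : Measurable fun w : (E J × E K) × (E J × E K) => w.1.2 := by fun_prop
  exact (h4.inner h1).add (h5.inner (h2.add h3))

end EntropicMeasurability

/-! ### The plug-in functional and its one-step expansion -/

section EntropicValue

variable {J K : ℕ}

/-- The plug-in functional `⟨c, p_L^η(b, c)⟩`. -/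
noncomputable def entropicValue (A : Matrix (Fin J) (Fin K) ℝ) (η : ℝ) (z : E J × E K) : ℝ :=
  ⟪z.2, entropicSol A η z.1 z.2⟫

lemma contDiffAt_entropicValue {A : Matrix (Fin J) (Fin K) ℝ} (hA : A.rank = J) {η : ℝ}
    (hη : 0 < η) {z : E J × E K} (hz : z.1 ∈ slaterSet A) :
    ContDiffAt ℝ ⊤ (entropicValue A η) z :=
  contDiffAt_snd.inner ℝ (contDiffAt_entropicSol hA hη hz)

/-- Product rule: differentiating `⟨c, p(b, c)⟩` yields `⟨φc, p⟩` from the explicit `c` and the two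
Jacobian terms from `p`. Joint differentiability lets the partial Jacobians add up to the full
derivative. -/
lemma entropicTerm_eq {A : Matrix (Fin J) (Fin K) ℝ} (hA : A.rank = J) {η : ℝ}
    (hη : 0 < η) {z : E J × E K} (hz : z.1 ∈ slaterSet A) (φ : E J × E K) :
    entropicTerm A η z.1 z.2 φ.1 φ.2 =
      entropicValue A η z + fderiv ℝ (entropicValue A η) z φ := by
  have hd := ((contDiffAt_entropicSol hA hη hz).differentiableAt (by simp)).hasFDerivAt
  have hB : jacB A η z.1 z.2 = _ := (HasFDerivAt.comp
    (g := fun z : E J × E K => entropicSol A η z.1 z.2) (f := fun b => (b, z.2)) z.1 hd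
      ((hasFDerivAt_id z.1).prodMk (hasFDerivAt_const z.2 z.1))).fderiv
  have hC : jacC A η z.1 z.2 = _ := (HasFDerivAt.comp
    (g := fun z : E J × E K => entropicSol A η z.1 z.2) (f := fun c => (z.1, c)) z.2 hd
      ((hasFDerivAt_const z.1 z.2).prodMk (hasFDerivAt_id z.2))).fderiv
  have hs := ((hasFDerivAt_snd (𝕜 := ℝ) (p := z)).inner ℝ hd).fderiv
  have hs' : fderiv ℝ (entropicValue A η) z φ = _ := congrArg (fun L => L φ) hs
  set D := fderiv ℝ (fun z : E J × E K => entropicSol A η z.1 z.2) z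
  have hφ : D φ = D (φ.1, 0) + D (0, φ.2) := by
    rw [← map_add]
    simp
  rw [hs', entropicTerm, hB, hC, entropicValue, inner_add_left]
  simp only [ContinuousLinearMap.comp_apply, ContinuousLinearMap.prod_apply,
    ContinuousLinearMap.id_apply, _root_.zero_apply, fderivInnerCLM_apply, hφ,
    ContinuousLinearMap.coe_snd']
  ring

end EntropicValue

/-! ### Uniform second-order Taylor bounds -/

section Taylor

/-- A closed thickening of the bounded set `R` is compact and stays in the region of smoothness, so
`s` and its first two derivatives are bounded there. The last bound expands around the perturbed
point `y`, because the estimator uses the derivative at the estimate. -/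
lemma exists_uniform_taylor_bound {F : Type*} [NormedAddCommGroup F] [NormedSpace ℝ F]
    [ProperSpace F] {s : F → ℝ} {R : Set F} (hR : Bornology.IsBounded R) {ρ : ℝ} (hρ : 0 < ρ)
    (hs : ∀ z ∈ R, ∀ y ∈ Metric.ball z ρ, ContDiffAt ℝ ⊤ s y) :
    ∃ δ : ℝ, 0 < δ ∧ ∃ M : ℝ, 0 ≤ M ∧ ∀ z ∈ R, ∀ y, ‖y - z‖ ≤ δ →
      |s y| ≤ M ∧ ‖fderiv ℝ s y‖ ≤ M ∧ |s y - s z| ≤ M * ‖y - z‖ ∧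
      ‖fderiv ℝ s y - fderiv ℝ s z‖ ≤ M * ‖y - z‖ ∧
      |s y + fderiv ℝ s y (z - y) - s z| ≤ M * ‖y - z‖ ^ 2 := by
  set C := Metric.cthickening (ρ / 2) R
  have hC : IsCompact C :=
    Metric.isCompact_of_isClosed_isBounded Metric.isClosed_cthickening hR.cthickening
  have hsC : ∀ y ∈ C, ContDiffAt ℝ ⊤ s y := by
    intro y hy
    obtain ⟨z, hz, hyz⟩ := Metric.mem_thickening_iff.1
      (Metric.cthickening_subset_thickening' hρ (half_lt_self hρ) R hy)
    exact hs z hz y hyz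
  have hd1 : ∀ y ∈ C, ContDiffAt ℝ ⊤ (fderiv ℝ s) y := fun y hy =>
    (hsC y hy).fderiv_right (by simp)
  have hd2 : ∀ y ∈ C, ContDiffAt ℝ ⊤ (fderiv ℝ (fderiv ℝ s)) y := fun y hy =>
    (hd1 y hy).fderiv_right (by simp)
  obtain ⟨M₀, hM₀⟩ := hC.exists_bound_of_continuousOn
    fun y hy => (hsC y hy).continuousAt.continuousWithinAt
  obtain ⟨M₁, hM₁⟩ := hC.exists_bound_of_continuousOn
    fun y hy => (hd1 y hy).continuousAt.continuousWithinAt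
  obtain ⟨M₂, hM₂⟩ := hC.exists_bound_of_continuousOn (f := fderiv ℝ (fderiv ℝ s))
    fun y hy => (hd2 y hy).continuousAt.continuousWithinAt
  set M := max (max M₁ M₂) (max M₀ 0)
  have hM0 : ∀ y ∈ C, |s y| ≤ M := fun y hy =>
    (hM₀ y hy).trans ((le_max_left _ _).trans (le_max_right _ _))
  have hM1 : ∀ y ∈ C, ‖fderiv ℝ s y‖ ≤ M := fun y hy =>
    (hM₁ y hy).trans ((le_max_left _ _).trans (le_max_left _ _))
  have hM2 : ∀ y ∈ C, ‖fderiv ℝ (fderiv ℝ s) y‖ ≤ M := fun y hy =>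
    (hM₂ y hy).trans ((le_max_right _ _).trans (le_max_left _ _))
  refine ⟨ρ / 2, half_pos hρ, M, (le_max_right _ _).trans (le_max_right _ _), fun z hz y hy => ?_⟩
  have hball : Metric.closedBall z (ρ / 2) ⊆ C :=
    Metric.closedBall_subset_cthickening hz _
  have hyb : y ∈ Metric.closedBall z (ρ / 2) := by rwa [mem_closedBall_iff_norm]
  have hzb : z ∈ Metric.closedBall z (ρ / 2) := Metric.mem_closedBall_self (half_pos hρ).le
  have hconv := convex_closedBall z (ρ / 2)
  have hlip : ∀ w ∈ Metric.closedBall z (ρ / 2), ∀ w' ∈ Metric.closedBall z (ρ / 2),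
      ‖fderiv ℝ s w - fderiv ℝ s w'‖ ≤ M * ‖w - w'‖ := fun w hw w' hw' =>
    hconv.norm_image_sub_le_of_norm_fderiv_le
      (fun x hx => (hd1 x (hball hx)).differentiableAt (by simp))
      (fun x hx => hM2 x (hball hx)) hw' hw
  refine ⟨hM0 y (hball hyb), hM1 y (hball hyb), ?_, hlip y hyb z hzb, ?_⟩
  · exact hconv.norm_image_sub_le_of_norm_fderiv_le
      (fun x hx => (hsC x (hball hx)).differentiableAt (by simp))
      (fun x hx => hM1 x (hball hx)) hzb hyb
  · have hseg : segment ℝ y z ⊆ Metric.closedBall z (ρ / 2) := hconv.segment_subset hyb hzb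
    have h := (convex_segment y z).norm_image_sub_le_of_norm_hasFDerivWithin_le'
      (f := s) (f' := fderiv ℝ s) (φ := fderiv ℝ s y) (C := M * ‖z - y‖)
      (fun x hx => ((hsC x (hball (hseg hx))).differentiableAt
        (by simp)).hasFDerivAt.hasFDerivWithinAt)
      (fun x hx => (hlip x (hseg hx) y hyb).trans (by
        gcongr
        exact norm_sub_le_of_mem_segment hx))
      (left_mem_segment ℝ y z) (right_mem_segment ℝ y z)
    rw [abs_sub_comm, ← Real.norm_eq_abs, ← sub_sub, norm_sub_rev y z]
    linarith

end Taylor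

/-! ### Conditional Chebyshev bound for sample-split remainders -/

section Chebyshev

variable {Ω 𝒪 : Type*} [MeasurableSpace Ω] [MeasurableSpace 𝒪] {P : Measure Ω}
  [IsProbabilityMeasure P] {Q : Measure 𝒪}

lemma memLp_two_of_lintegral_le {g : 𝒪 → ℝ} (hg : AEStronglyMeasurable g Q) {ε : ℝ}
    (h : ∫⁻ o, ‖g o‖ₑ ^ 2 ∂Q ≤ ENNReal.ofReal ε) : MemLp g 2 Q := by
  refine ⟨hg, ?_⟩
  rw [eLpNorm_lt_top_iff_lintegral_rpow_enorm_lt_top (by simp) (by simp)]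
  simpa using h.trans_lt ENNReal.ofReal_lt_top

/-- The normalized sum has mean at most `ε ≤ κ/2` in absolute value and variance at most `ε`;
exceeding `κ` forces a deviation of `κ/2` from the mean. -/
lemma measure_abs_inv_sqrt_mul_sum_ge_le {O : ℕ → Ω → 𝒪} (hO_law : ∀ i, HasLaw (O i) Q P)
    (hO_indep : iIndepFun O P) {g : 𝒪 → ℝ} (hg : Measurable g) {n : ℕ} (hn : 0 < n) {ε κ : ℝ}
    (hκ : 0 < κ) (hεκ : ε ≤ κ / 2) (hg2 : ∫⁻ o, ‖g o‖ₑ ^ 2 ∂Q ≤ ENNReal.ofReal ε)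
    (hg1 : √n * |∫ o, g o ∂Q| ≤ ε) :
    P {ω | κ ≤ |(√n)⁻¹ * ∑ i ∈ Finset.range n, g (O i ω)|} ≤
      ENNReal.ofReal (4 * ε / κ ^ 2) := by
  have hn' : (0 : ℝ) < n := by exact_mod_cast hn
  have hsq : 0 < √(n : ℝ) := Real.sqrt_pos.2 hn'
  have hε : 0 ≤ ε := (by positivity : 0 ≤ √(n : ℝ) * |∫ o, g o ∂Q|).trans hg1
  have hprob : IsProbabilityMeasure Q := by
    rw [← (hO_law 0).map_eq]
    exact Measure.isProbabilityMeasure_map (hO_law 0).aemeasurable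
  have hmem : MemLp g 2 Q := memLp_two_of_lintegral_le hg.aestronglyMeasurable hg2
  have hmemO : ∀ i, MemLp (fun ω => g (O i ω)) 2 P := fun i => by
    have h := hmem
    rw [← (hO_law i).map_eq] at h
    exact h.comp_of_map (hO_law i).aemeasurable
  have hmean : ∀ i, ∫ ω, g (O i ω) ∂P = ∫ o, g o ∂Q := fun i => by
    rw [← (hO_law i).map_eq, integral_map (hO_law i).aemeasurable hg.aestronglyMeasurable]
  have hvarO : ∀ i, Var[fun ω => g (O i ω); P] ≤ ε := fun i => by
    calc Var[fun ω => g (O i ω); P] ≤ ∫ ω, (g (O i ω)) ^ 2 ∂P :=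
          variance_le_expectation_sq (hmemO i).aestronglyMeasurable
      _ = ∫ o, g o ^ 2 ∂Q := by
        rw [← (hO_law i).map_eq, integral_map (hO_law i).aemeasurable
          (by fun_prop)]
      _ ≤ ε := by
        rw [integral_eq_lintegral_of_nonneg_ae (ae_of_all _ fun o => sq_nonneg _)
          (by fun_prop)]
        refine ENNReal.toReal_le_of_le_ofReal hε ?_
        refine le_of_eq_of_le (lintegral_congr fun o => ?_) hg2
        rw [← enorm_pow, Real.enorm_of_nonneg (sq_nonneg _)]
  set S : Ω → ℝ := ∑ i ∈ Finset.range n, fun ω => g (O i ω) with hS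
  have hSapp : ∀ ω, S ω = ∑ i ∈ Finset.range n, g (O i ω) := fun ω => by simp [hS]
  have hSmem : MemLp S 2 P := memLp_finsetSum' _ fun i _ => hmemO i
  have hSmean : ∫ ω, S ω ∂P = n * ∫ o, g o ∂Q := by
    simp_rw [hSapp]
    rw [integral_finsetSum _ fun i _ => (hmemO i).integrable (by norm_num)]
    simp [hmean]
  have hSvar : Var[S; P] ≤ n * ε := by
    rw [hS, IndepFun.variance_sum (fun i _ => hmemO i) fun i _ j _ hij =>
      (hO_indep.indepFun hij).comp hg hg]
    calc ∑ i ∈ Finset.range n, Var[fun ω => g (O i ω); P] ≤ ∑ i ∈ Finset.range n, ε :=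
          Finset.sum_le_sum fun i _ => hvarO i
      _ = n * ε := by simp
  have hc : 0 < √(n : ℝ) * (κ / 2) := by positivity
  refine (measure_mono fun ω hω => ?_).trans
    ((meas_ge_le_variance_div_sq hSmem hc).trans (ENNReal.ofReal_le_ofReal ?_))
  · simp only [Set.mem_ofPred_eq] at hω ⊢
    rw [hSmean, hSapp]
    rw [abs_mul, abs_of_pos (inv_pos.2 hsq), ← div_eq_inv_mul, le_div_iff₀ hsq] at hω
    have h1 : |(n : ℝ) * ∫ o, g o ∂Q| ≤ √(n : ℝ) * (κ / 2) := by
      rw [abs_mul, abs_of_pos hn']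
      nth_rw 1 [← Real.mul_self_sqrt hn'.le]
      rw [mul_assoc]
      gcongr
      exact hg1.trans hεκ
    have h2 := abs_sub_abs_le_abs_sub (∑ i ∈ Finset.range n, g (O i ω)) (n * ∫ o, g o ∂Q)
    linarith
  · rw [mul_pow, Real.sq_sqrt hn'.le, div_le_div_iff₀ (by positivity) (by positivity)]
    nlinarith [mul_le_mul_of_nonneg_right hSvar (sq_nonneg κ)]

lemma tendstoInMeasure_inv_sqrt_mul_sum [IsProbabilityMeasure Q]
    {O : ℕ → Ω → 𝒪} (hO_law : ∀ i, HasLaw (O i) Q P)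
    (hO_indep : iIndepFun O P) {𝒲 : ℕ → Type*} [∀ n, MeasurableSpace (𝒲 n)]
    {W : ∀ n, Ω → 𝒲 n} (hW : ∀ n, Measurable (W n))
    (hW_indep : ∀ n, IndepFun (W n) (fun ω (i : Fin n) => O i ω) P)
    {D : ∀ n, 𝒲 n → 𝒪 → ℝ} (hD : ∀ n, Measurable (Function.uncurry (D n)))
    (hgood : ∀ ε : ℝ, 0 < ε → Tendsto (fun n => P {ω | ¬ (
      ∫⁻ o, ‖D n (W n ω) o‖ₑ ^ 2 ∂Q ≤ ENNReal.ofReal ε ∧ √n * |∫ o, D n (W n ω) o ∂Q| ≤ ε)})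
      atTop (𝓝 0)) :
    TendstoInMeasure P (fun (n : ℕ) ω => (√n)⁻¹ * ∑ i ∈ Finset.range n, D n (W n ω) (O i ω))
      atTop (fun _ => 0) := by
  rw [tendstoInMeasure_iff_norm]
  intro κ hκ
  simp only [sub_zero, Real.norm_eq_abs]
  rw [ENNReal.tendsto_nhds_zero]
  intro τ hτ
  obtain ⟨ε, hε, hεκ, hετ⟩ : ∃ ε : ℝ, 0 < ε ∧ ε ≤ κ / 2 ∧
      ENNReal.ofReal (4 * ε / κ ^ 2) ≤ τ / 2 := by
    have h1 : Tendsto (fun ε : ℝ => ENNReal.ofReal (4 * ε / κ ^ 2)) (𝓝[>] 0) (𝓝 0) := by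
      have h2 : Continuous fun ε : ℝ => ENNReal.ofReal (4 * ε / κ ^ 2) :=
        ENNReal.continuous_ofReal.comp (by fun_prop)
      have h3 := h2.tendsto 0
      simp only [mul_zero, zero_div, ENNReal.ofReal_zero] at h3
      exact h3.mono_left nhdsWithin_le_nhds
    have h4 := ENNReal.tendsto_nhds_zero.1 h1 (τ / 2) (ENNReal.half_pos hτ.ne')
    have h5 : ∀ᶠ ε : ℝ in 𝓝[>] 0, ε ≤ κ / 2 :=
      nhdsWithin_le_nhds (Iic_mem_nhds (by positivity))
    have h8 : ∀ᶠ ε : ℝ in 𝓝[>] 0, 0 < ε := self_mem_nhdsWithin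
    obtain ⟨ε, hε, h6, h7⟩ := (h8.and (h5.and h4)).exists
    exact ⟨ε, hε, h6, h7⟩
  filter_upwards [ENNReal.tendsto_nhds_zero.1 (hgood ε hε) (τ / 2) (ENNReal.half_pos hτ.ne'),
    eventually_gt_atTop 0] with n hn hn0
  -- The good training samples. Expressed through integrals of `D n w`, this set is measurable in
  -- `w`, so by independence Fubini applies and Chebyshev can be used for each fixed `w ∈ G`.
  let G : Set (𝒲 n) := {w | ∫⁻ o, ‖D n w o‖ₑ ^ 2 ∂Q ≤ ENNReal.ofReal ε} ∩
    {w | √n * |∫ o, D n w o ∂Q| ≤ ε}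
  have hG : MeasurableSet G := by
    refine MeasurableSet.inter (measurableSet_le ?_ measurable_const)
      (measurableSet_le ?_ measurable_const)
    · exact ((hD n).enorm.pow_const 2).lintegral_prod_right'
    · exact ((hD n).stronglyMeasurable.integral_prod_right').measurable.abs.const_mul _
  let T : Set (𝒲 n × (Fin n → 𝒪)) := Prod.fst ⁻¹' G ∩
    {z | κ ≤ |(√n)⁻¹ * ∑ i, D n z.1 (z.2 i)|}
  have hT : MeasurableSet T := by
    refine (measurable_fst hG).inter (measurableSet_le measurable_const ?_)
    refine (Measurable.const_mul (Finset.measurable_fun_sum _ fun i _ => ?_) _).abs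
    exact (hD n).comp (f := fun z : 𝒲 n × (Fin n → 𝒪) => (z.1, z.2 i)) (by fun_prop)
  have hO : AEMeasurable (fun ω (i : Fin n) => O i ω) P :=
    aemeasurable_pi_lambda _ fun i => (hO_law i).aemeasurable
  have hTP : P {ω | (W n ω, fun i : Fin n => O i ω) ∈ T} ≤ τ / 2 := by
    have h1 : P {ω | (W n ω, fun i : Fin n => O i ω) ∈ T} =
        P.map (fun ω => (W n ω, fun i : Fin n => O i ω)) T :=
      (Measure.map_apply_of_aemeasurable ((hW n).aemeasurable.prodMk hO) hT).symm
    have hpW := Measure.isProbabilityMeasure_map (μ := P) (hW n).aemeasurable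
    have hpO := Measure.isProbabilityMeasure_map (μ := P) hO
    rw [h1, (indepFun_iff_map_prod_eq_prod_map_map (hW n).aemeasurable hO).1 (hW_indep n),
      Measure.prod_apply hT]
    calc ∫⁻ w, P.map (fun ω (i : Fin n) => O i ω) (Prod.mk w ⁻¹' T) ∂P.map (W n)
        ≤ ∫⁻ _, τ / 2 ∂P.map (W n) := by
          refine lintegral_mono fun w => ?_
          rw [Measure.map_apply_of_aemeasurable hO (measurable_prodMk_left hT)]
          by_cases hw : w ∈ G
          · refine (measure_mono fun ω hω => ?_).trans
              ((measure_abs_inv_sqrt_mul_sum_ge_le hO_law hO_indep (g := D n w)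
                ((hD n).comp measurable_prodMk_left) hn0 hκ hεκ hw.1 hw.2).trans hετ)
            have h2 := hω.2
            simpa only [Set.mem_ofPred_eq, Finset.sum_range] using h2
          · have hempty : (fun ω (i : Fin n) => O i ω) ⁻¹' (Prod.mk w ⁻¹' T) = ∅ := by
              ext ω
              exact ⟨fun hω => hw hω.1, fun h => h.elim⟩
            rw [hempty, measure_empty]
            exact zero_le
      _ = τ / 2 := by simp
  calc P {ω | κ ≤ |(√n)⁻¹ * ∑ i ∈ Finset.range n, D n (W n ω) (O i ω)|}
      ≤ P ({ω | ¬ (W n ω ∈ G)} ∪ {ω | (W n ω, fun i : Fin n => O i ω) ∈ T}) := by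
        refine measure_mono fun ω hω => ?_
        by_cases hw : W n ω ∈ G
        · refine Or.inr ⟨hw, ?_⟩
          simpa only [Set.mem_ofPred_eq, Finset.sum_range] using hω
        · exact Or.inl hw
    _ ≤ τ / 2 + τ / 2 := (measure_union_le _ _).trans (add_le_add hn hTP)
    _ = τ := ENNReal.add_halves τ

end Chebyshev

/-! ### Partial gradients as test functions -/

section PartialGradients

variable {J K : ℕ}

/-- The gradient of `s` in the first argument. -/
noncomputable def gradFst (s : E J × E K → ℝ) (z : E J × E K) : E J :=
  (InnerProductSpace.toDual ℝ (E J)).symm (fderiv ℝ s z ∘L ContinuousLinearMap.inl ℝ _ _)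

/-- The gradient of `s` in the second argument. -/
noncomputable def gradSnd (s : E J × E K → ℝ) (z : E J × E K) : E K :=
  (InnerProductSpace.toDual ℝ (E K)).symm (fderiv ℝ s z ∘L ContinuousLinearMap.inr ℝ _ _)

lemma fderiv_apply_eq_inner_grad (s : E J × E K → ℝ) (z v : E J × E K) :
    fderiv ℝ s z v = ⟪gradFst s z, v.1⟫ + ⟪gradSnd s z, v.2⟫ := by
  rw [gradFst, gradSnd, InnerProductSpace.toDual_symm_apply, InnerProductSpace.toDual_symm_apply]
  simp [← map_add]

lemma measurable_gradFst (s : E J × E K → ℝ) : Measurable (gradFst s) := by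
  refine (InnerProductSpace.toDual ℝ (E J)).symm.continuous.measurable.comp ?_
  exact (((ContinuousLinearMap.compL ℝ (E J) (E J × E K) ℝ).flip
    (ContinuousLinearMap.inl ℝ _ _)).continuous.measurable).comp (measurable_fderiv ℝ s)

lemma measurable_gradSnd (s : E J × E K → ℝ) : Measurable (gradSnd s) := by
  refine (InnerProductSpace.toDual ℝ (E K)).symm.continuous.measurable.comp ?_
  exact (((ContinuousLinearMap.compL ℝ (E K) (E J × E K) ℝ).flip
    (ContinuousLinearMap.inr ℝ _ _)).continuous.measurable).comp (measurable_fderiv ℝ s)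

lemma norm_gradFst_le (s : E J × E K → ℝ) (z : E J × E K) :
    ‖gradFst s z‖ ≤ ‖fderiv ℝ s z‖ := by
  rw [gradFst, LinearIsometryEquiv.norm_map]
  refine (ContinuousLinearMap.opNorm_comp_le _ _).trans ?_
  exact mul_le_of_le_one_right (norm_nonneg _) (ContinuousLinearMap.norm_inl_le_one ℝ _ _)

lemma norm_gradSnd_le (s : E J × E K → ℝ) (z : E J × E K) :
    ‖gradSnd s z‖ ≤ ‖fderiv ℝ s z‖ := by
  rw [gradSnd, LinearIsometryEquiv.norm_map]
  refine (ContinuousLinearMap.opNorm_comp_le _ _).trans ?_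
  exact mul_le_of_le_one_right (norm_nonneg _) (ContinuousLinearMap.norm_inr_le_one ℝ _ _)

lemma aestronglyMeasurable_fderiv_apply {α : Type*} [MeasurableSpace α] {μ : Measure α}
    (s : E J × E K → ℝ) {z v : α → E J × E K} (hz : Measurable z)
    (hv : AEStronglyMeasurable v μ) :
    AEStronglyMeasurable (fun a => fderiv ℝ s (z a) (v a)) μ := by
  simp only [fderiv_apply_eq_inner_grad]
  exact (((measurable_gradFst s).comp hz).aestronglyMeasurable.inner
    (continuous_fst.comp_aestronglyMeasurable hv)).add
      (((measurable_gradSnd s).comp hz).aestronglyMeasurable.inner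
        (continuous_snd.comp_aestronglyMeasurable hv))

end PartialGradients

/-! ### Bias of the one-step expression -/

section PluginRemainder

variable {𝒳 𝒪 : Type*} [MeasurableSpace 𝒳] [MeasurableSpace 𝒪] {Q : Measure 𝒪}
  {X : 𝒪 → 𝒳} {J K : ℕ} {s : E J × E K → ℝ} {z : 𝒳 → E J × E K}
  {φ : 𝒪 → E J × E K} {M : ℝ}

lemma integrable_fderiv_apply (hX : Measurable X) (hz : Measurable z)
    (hM : ∀ x, ‖fderiv ℝ s (z x)‖ ≤ M) (hφ : Integrable φ Q) :
    Integrable (fun o => fderiv ℝ s (z (X o)) (φ o)) Q := by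
  refine (hφ.norm.const_mul M).mono'
    (aestronglyMeasurable_fderiv_apply s (hz.comp hX) hφ.aestronglyMeasurable)
    (ae_of_all _ fun o => ?_)
  exact ((fderiv ℝ s (z (X o))).le_opNorm _).trans
    (mul_le_mul_of_nonneg_right (hM _) (norm_nonneg _))

lemma integrable_inner_of_norm_le {d : ℕ} {f : 𝒳 → E d} {v : 𝒪 → E d} (hX : Measurable X)
    (hf : Measurable f) (hM : ∀ x, ‖f x‖ ≤ M) (hv : Integrable v Q) :
    Integrable (fun o => ⟪f (X o), v o⟫) Q := by
  refine (hv.norm.const_mul M).mono'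
    ((hf.comp hX).aestronglyMeasurable.inner hv.aestronglyMeasurable) (ae_of_all _ fun o => ?_)
  exact (norm_inner_le_norm _ _).trans (mul_le_mul_of_nonneg_right (hM _) (norm_nonneg _))

variable [IsProbabilityMeasure Q]

lemma integrable_comp_of_bound (hX : Measurable X) (hz : Measurable z) (hs : Measurable s)
    (hM : ∀ x, |s (z x)| ≤ M) : Integrable (fun o => s (z (X o))) Q :=
  Integrable.of_bound (hs.comp (hz.comp hX)).aestronglyMeasurable M (ae_of_all _ fun o => hM (X o))

lemma integral_add_fderiv_eq (hX : Measurable X) (hz : Measurable z) (hs : Measurable s)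
    (hsM : ∀ x, |s (z x)| ≤ M) (hM : ∀ x, ‖fderiv ℝ s (z x)‖ ≤ M) (hφ : Integrable φ Q)
    (hφ_fst : ∀ f : 𝒳 → E J, Measurable f → ∀ B : ℝ, (∀ x, ‖f x‖ ≤ B) →
      ∫ o, ⟪f (X o), (φ o).1⟫ ∂Q = 0)
    (hφ_snd : ∀ f : 𝒳 → E K, Measurable f → ∀ B : ℝ, (∀ x, ‖f x‖ ≤ B) →
      ∫ o, ⟪f (X o), (φ o).2⟫ ∂Q = 0) :
    ∫ o, (s (z (X o)) + fderiv ℝ s (z (X o)) (φ o)) ∂Q = ∫ o, s (z (X o)) ∂Q := by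
  rw [integral_add (integrable_comp_of_bound hX hz hs hsM)
    (integrable_fderiv_apply hX hz hM hφ), add_eq_left]
  have hg1 := (measurable_gradFst s).comp hz
  have hg2 := (measurable_gradSnd s).comp hz
  have hb1 : ∀ x, ‖(gradFst s ∘ z) x‖ ≤ M := fun x => (norm_gradFst_le s _).trans (hM x)
  have hb2 : ∀ x, ‖(gradSnd s ∘ z) x‖ ≤ M := fun x => (norm_gradSnd_le s _).trans (hM x)
  have h1 := integrable_inner_of_norm_le hX hg1 hb1 hφ.fst
  have h2 := integrable_inner_of_norm_le hX hg2 hb2 hφ.snd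
  have h3 := hφ_fst _ hg1 M hb1
  have h4 := hφ_snd _ hg2 M hb2
  simp only [Function.comp_apply] at h1 h2 h3 h4
  simp only [fderiv_apply_eq_inner_grad]
  rw [integral_add h1 h2, h3, h4, add_zero]

/-- With `z`, `ẑ` the true and estimated pairs, `s(ẑ) + Ds(ẑ) φ̂ - s(z)` is the Taylor remainder
`s(ẑ) + Ds(ẑ)(z - ẑ) - s(z)` plus `Ds(ẑ)(ẑ + φ̂ - z)`. The first part is quadratic in the errors;
the second is the de-biased error tested against the gradients at `ẑ`, bounded functions of `X`. -/
lemma abs_integral_plugin_sub_le (hX : Measurable X) (hs : Measurable s)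
    {b bh : 𝒳 → E J} {c ch : 𝒳 → E K} (hb : Measurable b) (hbh : Measurable bh)
    (hc : Measurable c) (hch : Measurable ch) {φbh : 𝒪 → E J} {φch : 𝒪 → E K}
    (hφbh : Integrable φbh Q) (hφch : Integrable φch Q) {δ : ℝ} (hM0 : 0 ≤ M)
    (hδ : ∀ x, ‖(bh x, ch x) - (b x, c x)‖ ≤ δ)
    (hsz : ∀ x, |s (b x, c x)| ≤ M) (hszh : ∀ x, |s (bh x, ch x)| ≤ M)
    (hD : ∀ x, ‖fderiv ℝ s (bh x, ch x)‖ ≤ M)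
    (htaylor : ∀ x, |s (bh x, ch x) + fderiv ℝ s (bh x, ch x) ((b x, c x) - (bh x, ch x)) -
      s (b x, c x)| ≤ M * ‖(bh x, ch x) - (b x, c x)‖ ^ 2)
    {Rb Rc : ℝ} (hRb : DebiasedBound Q X b bh φbh Rb) (hRc : DebiasedBound Q X c ch φch Rc) :
    |∫ o, (s (bh (X o), ch (X o)) + fderiv ℝ s (bh (X o), ch (X o)) (φbh o, φch o)) ∂Q -
        ∫ o, s (b (X o), c (X o)) ∂Q| ≤
      M * (∫ o, ‖bh (X o) - b (X o)‖ ^ 2 ∂Q + ∫ o, ‖ch (X o) - c (X o)‖ ^ 2 ∂Q) +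
        M * Rb + M * Rc := by
  have hzh : Measurable fun x => (bh x, ch x) := hbh.prodMk hch
  have hz : Measurable fun x => (b x, c x) := hb.prodMk hc
  have hdb : ∀ x, ‖bh x - b x‖ ≤ δ := fun x => (norm_fst_le _).trans (hδ x)
  have hdc : ∀ x, ‖ch x - c x‖ ≤ δ := fun x => (norm_snd_le _).trans (hδ x)
  have hib : Integrable (fun o => bh (X o) - b (X o)) Q :=
    Integrable.of_bound ((hbh.sub hb).comp hX).aestronglyMeasurable δ
      (ae_of_all _ fun o => hdb _)
  have hic : Integrable (fun o => ch (X o) - c (X o)) Q :=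
    Integrable.of_bound ((hch.sub hc).comp hX).aestronglyMeasurable δ
      (ae_of_all _ fun o => hdc _)
  have hib2 : Integrable (fun o => ‖bh (X o) - b (X o)‖ ^ 2) Q :=
    Integrable.of_bound (((hbh.sub hb).comp hX).norm.pow_const 2).aestronglyMeasurable (δ ^ 2)
      (ae_of_all _ fun o => by
        rw [Real.norm_of_nonneg (by positivity)]
        exact pow_le_pow_left₀ (norm_nonneg _) (hdb _) 2)
  have hic2 : Integrable (fun o => ‖ch (X o) - c (X o)‖ ^ 2) Q :=
    Integrable.of_bound (((hch.sub hc).comp hX).norm.pow_const 2).aestronglyMeasurable (δ ^ 2)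
      (ae_of_all _ fun o => by
        rw [Real.norm_of_nonneg (by positivity)]
        exact pow_le_pow_left₀ (norm_nonneg _) (hdc _) 2)
  have hvb : Integrable (fun o => bh (X o) + φbh o - b (X o)) Q := by
    refine (hib.add hφbh).congr (ae_of_all _ fun o => ?_)
    simp only [Pi.add_apply]
    abel
  have hvc : Integrable (fun o => ch (X o) + φch o - c (X o)) Q := by
    refine (hic.add hφch).congr (ae_of_all _ fun o => ?_)
    simp only [Pi.add_apply]
    abel
  have hg1 := (measurable_gradFst s).comp hzh
  have hg2 := (measurable_gradSnd s).comp hzh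
  have hb1 : ∀ x, ‖(gradFst s ∘ fun x => (bh x, ch x)) x‖ ≤ M := fun x =>
    (norm_gradFst_le s _).trans (hD x)
  have hb2 : ∀ x, ‖(gradSnd s ∘ fun x => (bh x, ch x)) x‖ ≤ M := fun x =>
    (norm_gradSnd_le s _).trans (hD x)
  have hi1 := integrable_inner_of_norm_le hX hg1 hb1 hvb
  have hi2 := integrable_inner_of_norm_le hX hg2 hb2 hvc
  have he1 := hRb _ hg1 M hb1
  have he2 := hRc _ hg2 M hb2
  simp only [Function.comp_apply] at hi1 hi2 he1 he2
  set T : 𝒪 → ℝ := fun o => s (bh (X o), ch (X o)) + fderiv ℝ s (bh (X o), ch (X o))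
    ((b (X o), c (X o)) - (bh (X o), ch (X o))) - s (b (X o), c (X o)) with hT
  have hiz := integrable_comp_of_bound (Q := Q) hX hz hs hsz
  have hizh := integrable_comp_of_bound (Q := Q) hX hzh hs hszh
  have hiT : Integrable T Q := by
    refine (hizh.add (integrable_fderiv_apply hX hzh hD (φ := fun o =>
      (b (X o), c (X o)) - (bh (X o), ch (X o))) ?_)).sub hiz
    refine (hib.neg.prodMk hic.neg).congr (ae_of_all _ fun o => ?_)
    simp
  have hidφ := integrable_fderiv_apply hX hzh hD (hφbh.prodMk hφch)
  have hkey : ∫ o, (s (bh (X o), ch (X o)) + fderiv ℝ s (bh (X o), ch (X o)) (φbh o, φch o)) ∂Q -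
      ∫ o, s (b (X o), c (X o)) ∂Q = ∫ o, T o ∂Q +
        ∫ o, ⟪gradFst s (bh (X o), ch (X o)), bh (X o) + φbh o - b (X o)⟫ ∂Q +
        ∫ o, ⟪gradSnd s (bh (X o), ch (X o)), ch (X o) + φch o - c (X o)⟫ ∂Q := by
    have hi0 : Integrable (fun o => s (bh (X o), ch (X o)) +
        fderiv ℝ s (bh (X o), ch (X o)) (φbh o, φch o)) Q := hizh.add hidφ
    have hi3 : Integrable (fun o => T o +
        ⟪gradFst s (bh (X o), ch (X o)), bh (X o) + φbh o - b (X o)⟫) Q := hiT.add hi1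
    rw [← integral_sub hi0 hiz, ← integral_add hiT hi1, ← integral_add hi3 hi2]
    refine integral_congr_ae (ae_of_all _ fun o => ?_)
    simp only [hT, fderiv_apply_eq_inner_grad, Prod.mk_sub_mk, inner_add_right, inner_sub_right]
    ring
  have hTle : |∫ o, T o ∂Q| ≤
      M * (∫ o, ‖bh (X o) - b (X o)‖ ^ 2 ∂Q + ∫ o, ‖ch (X o) - c (X o)‖ ^ 2 ∂Q) := by
    have hi3 : Integrable (fun o => ‖bh (X o) - b (X o)‖ ^ 2 + ‖ch (X o) - c (X o)‖ ^ 2) Q :=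
      hib2.add hic2
    rw [← integral_add hib2 hic2, ← integral_const_mul, ← Real.norm_eq_abs]
    refine norm_integral_le_of_norm_le (f := T) (hi3.const_mul M) (ae_of_all _ fun o => ?_)
    refine (htaylor (X o)).trans (mul_le_mul_of_nonneg_left ?_ hM0)
    rw [Prod.mk_sub_mk, Prod.norm_mk]
    rcases max_choice ‖bh (X o) - b (X o)‖ ‖ch (X o) - c (X o)‖ with h | h <;> rw [h]
    · exact le_add_of_nonneg_right (by positivity)
    · exact le_add_of_nonneg_left (by positivity)
  rw [hkey]
  exact (abs_add_three _ _ _).trans (add_le_add (add_le_add hTle he1) he2)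

end PluginRemainder

/-! ### Translating the rate assumptions into high-probability events -/

section Rates

variable {Ω 𝒳 𝒪 : Type*} [MeasurableSpace Ω] [MeasurableSpace 𝒳] [MeasurableSpace 𝒪]
  {P : Measure Ω} {Q : Measure 𝒪}

lemma tendsto_measure_not_forall_norm_le {α : Type*} {d : ℕ} {Z : ℕ → Ω → α → E d}
    (h : ∀ j, IsLittleOp P (fun n ω => ⨆ x, ‖Z n ω x j‖ₑ) (fun _ => 1)) {δ : ℝ} (hδ : 0 < δ) :
    Tendsto (fun n => P {ω | ¬ ∀ x, ‖Z n ω x‖ ≤ δ}) atTop (𝓝 0) := by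
  -- Dividing by `d + 1` rather than `d` also covers dimension zero; `d` coordinates then contribute
  -- at most `δ`.
  have hd : 0 < δ / (d + 1) := by positivity
  have hsum : Tendsto (fun n => ∑ j, P {ω | ENNReal.ofReal (δ / (d + 1) * 1) <
      ⨆ x, ‖Z n ω x j‖ₑ}) atTop (𝓝 0) := by
    simpa using tendsto_finsetSum Finset.univ fun j _ => h j _ hd
  refine tendsto_of_tendsto_of_tendsto_of_le_of_le tendsto_const_nhds hsum (fun _ => zero_le)
    fun n => (measure_mono fun ω hω => ?_).trans (measure_iUnion_fintype_le P _)
  simp only [Set.mem_ofPred_eq, not_forall, not_le, Set.mem_iUnion] at hω ⊢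
  obtain ⟨x, hx⟩ := hω
  by_contra! hle
  have hcoord : ∀ j, |Z n ω x j| ≤ δ / (d + 1) := fun j => by
    have h1 := (le_iSup (fun x => ‖Z n ω x j‖ₑ) x).trans (hle j)
    rw [mul_one, Real.enorm_eq_ofReal_abs] at h1
    exact (ENNReal.ofReal_le_ofReal_iff hd.le).1 h1
  have h2 := euclideanNorm_le_sum_abs (Z n ω x)
  have h3 : ∑ j, |Z n ω x j| ≤ d * (δ / (d + 1)) := by
    simpa using Finset.sum_le_sum fun j (_ : j ∈ Finset.univ) => hcoord j
  have h4 : d * (δ / (d + 1)) ≤ δ := by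
    rw [mul_div_assoc', div_le_iff₀ (by positivity)]
    nlinarith
  linarith

lemma tendsto_measure_not_debiasedBound [Nonempty 𝒳] {d : ℕ} {X : 𝒪 → 𝒳} {g : 𝒳 → E d}
    {ghat : ℕ → Ω → 𝒳 → E d} {φhat : ℕ → Ω → 𝒪 → E d} {r : ℕ → ℝ}
    (h : ∀ δ : ℝ, 0 < δ → ∃ C : ℝ, ∀ᶠ n in atTop,
      P {ω | ¬ DebiasedBound Q X g (ghat n ω) (φhat n ω) (C * r n)} ≤ ENNReal.ofReal δ)
    (hr : r =o[atTop] fun n => (n : ℝ) ^ (-(1 / 2) : ℝ)) {ε : ℝ} (hε : 0 < ε) :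
    Tendsto (fun n : ℕ => P {ω | ¬ DebiasedBound Q X g (ghat n ω) (φhat n ω) (ε / √n)})
      atTop (𝓝 0) := by
  rw [ENNReal.tendsto_nhds_zero]
  intro τ hτ
  obtain ⟨δ, hδ, hδτ⟩ : ∃ δ : ℝ, 0 < δ ∧ ENNReal.ofReal δ ≤ τ := by
    rcases eq_or_ne τ ∞ with rfl | h
    · exact ⟨1, one_pos, le_top⟩
    · exact ⟨τ.toReal, ENNReal.toReal_pos hτ.ne' h, ENNReal.ofReal_toReal_le⟩
  obtain ⟨C, hC⟩ := h δ hδ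
  have hr' := hr.bound (show 0 < ε / (|C| + 1) by positivity)
  filter_upwards [hC, hr', eventually_gt_atTop 0] with n hn hrn hn0
  refine (measure_mono fun ω hω => ?_).trans (hn.trans hδτ)
  simp only [Set.mem_ofPred_eq] at hω ⊢
  refine fun hdb => hω ?_
  intro f hf M hM
  -- A bound `M` on `‖f‖` is automatically nonnegative only when there is a covariate value to
  -- evaluate at.
  have hM0 : 0 ≤ M := (norm_nonneg _).trans (hM (Classical.arbitrary 𝒳))
  refine (hdb f hf M hM).trans (mul_le_mul_of_nonneg_left ?_ hM0)
  have hn' : (0 : ℝ) < n := by exact_mod_cast hn0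
  have hpow : (n : ℝ) ^ (-(1 / 2) : ℝ) = (√(n : ℝ))⁻¹ := by
    rw [Real.rpow_neg hn'.le, Real.sqrt_eq_rpow]
  rw [hpow, Real.norm_eq_abs, Real.norm_of_nonneg (by positivity)] at hrn
  calc C * r n ≤ |C| * |r n| := by rw [← abs_mul]; exact le_abs_self _
    _ ≤ (|C| + 1) * (ε / (|C| + 1) * (√(n : ℝ))⁻¹) := by
      gcongr
      linarith
    _ = ε / √n := by
      field_simp

lemma tendsto_measure_not_sqrt_mul_integral_sq_le {d : ℕ} {Z : ℕ → Ω → 𝒪 → E d}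
    (hZ : ∀ n ω, AEStronglyMeasurable (Z n ω) Q)
    (h : IsLittleOp P (fun n ω => eLpNorm (Z n ω) 2 Q) (fun n => (n : ℝ) ^ (-(1 / 4) : ℝ)))
    {ε : ℝ} (hε : 0 < ε) :
    Tendsto (fun n : ℕ => P {ω | ¬ √n * ∫ o, ‖Z n ω o‖ ^ 2 ∂Q ≤ ε}) atTop (𝓝 0) := by
  refine tendsto_of_tendsto_of_tendsto_of_le_of_le tendsto_const_nhds
    (h (√ε) (Real.sqrt_pos.2 hε)) (fun _ => zero_le) fun n => measure_mono fun ω hω => ?_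
  simp only [Set.mem_ofPred_eq] at hω ⊢
  by_contra! hle
  refine hω ?_
  rcases Nat.eq_zero_or_pos n with rfl | hn
  · simpa using hε.le
  have hn' : (0 : ℝ) < n := by exact_mod_cast hn
  have hmem : MemLp (Z n ω) 2 Q := ⟨hZ n ω, hle.trans_lt ENNReal.ofReal_lt_top⟩
  rw [hmem.eLpNorm_eq_integral_rpow_norm (by simp) (by simp)] at hle
  rw [ENNReal.ofReal_le_ofReal_iff (by positivity)] at hle
  simp only [ENNReal.toReal_ofNat, Real.rpow_ofNat] at hle
  have hI : 0 ≤ ∫ o, ‖Z n ω o‖ ^ 2 ∂Q := integral_nonneg fun o => by positivity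
  have h1 : ∫ o, ‖Z n ω o‖ ^ 2 ∂Q ≤ ε * (√(n : ℝ))⁻¹ := by
    have h2 := pow_le_pow_left₀ (by positivity) hle 2
    rw [← Real.rpow_natCast, ← Real.rpow_mul hI, mul_pow, Real.sq_sqrt hε.le,
      ← Real.rpow_natCast, ← Real.rpow_mul hn'.le] at h2
    norm_num at h2
    rwa [Real.rpow_neg hn'.le, ← Real.sqrt_eq_rpow] at h2
  calc √(n : ℝ) * ∫ o, ‖Z n ω o‖ ^ 2 ∂Q ≤ √(n : ℝ) * (ε * (√(n : ℝ))⁻¹) := by gcongr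
    _ = ε := by field_simp

end Rates

/-! ### Deterministic remainder bounds for the entropic summand -/

section EntropicRemainder

variable {𝒳 𝒪 : Type*} {J K : ℕ} {A : Matrix (Fin J) (Fin K) ℝ} {η : ℝ}
  {b : 𝒳 → E J} {c : 𝒳 → E K}

/-- One radius serves all `β` by translation: let `u` be the constant vector `ε`. A ball around `A
u` lies in the open Slater set, and since some feasible `p` satisfies `p ≥ u`, adding `p - u ≥ 0`
carries that ball to one around `β`. -/
lemma exists_ball_subset_slaterSet (hA : A.rank = J) {ε : ℝ} (hε : 0 < ε) :
    ∃ ρ : ℝ, 0 < ρ ∧ ∀ β, (∃ p ∈ feasibleSet A β, ∀ k, ε ≤ p k) →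
      Metric.ball β ρ ⊆ slaterSet A := by
  let u : E K := WithLp.toLp 2 fun _ => ε
  obtain ⟨ρ, hρ, hball⟩ := Metric.isOpen_iff.1 (isOpen_slaterSet hA) (constraintMap A u)
    ⟨u, fun _ => hε, rfl⟩
  refine ⟨ρ, hρ, ?_⟩
  rintro β ⟨p, hp, hpε⟩ y hy
  obtain ⟨q, hq, hqy⟩ : y - β + constraintMap A u ∈ slaterSet A := by
    apply hball
    rw [mem_ball_iff_norm] at hy ⊢
    rwa [add_sub_cancel_right]
  refine ⟨q + p - u, fun k => ?_, ?_⟩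
  · have h1 : (q + p - u) k = q k + p k - ε := rfl
    rw [h1]
    linarith [hq k, hpε k]
  · rw [map_sub, map_add, hqy, (mem_feasibleSet_iff.1 hp).2]
    abel

lemma exists_norm_le_of_forall_coord_le {d : ℕ} {g : 𝒳 → E d} (h : ∃ B : ℝ, ∀ x j, |g x j| ≤ B) :
    ∃ B : ℝ, ∀ x, ‖g x‖ ≤ B := by
  obtain ⟨B, hB⟩ := h
  exact ⟨∑ _j : Fin d, B, fun x => (euclideanNorm_le_sum_abs _).trans
    (Finset.sum_le_sum fun j _ => hB x j)⟩

lemma exists_entropicValue_taylor_bound (hA : A.rank = J) (hη : 0 < η)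
    (hb_bdd : ∃ B : ℝ, ∀ x j, |b x j| ≤ B) (hc_bdd : ∃ B : ℝ, ∀ x k, |c x k| ≤ B)
    (hfeas : ∃ ε : ℝ, 0 < ε ∧ ∀ x, ∃ p ∈ feasibleSet A (b x), ∀ k, ε ≤ p k) :
    ∃ δ : ℝ, 0 < δ ∧ ∃ M : ℝ, 0 ≤ M ∧ ∀ x, ∀ y : E J × E K, ‖y - (b x, c x)‖ ≤ δ →
      y.1 ∈ slaterSet A ∧ |entropicValue A η y| ≤ M ∧ ‖fderiv ℝ (entropicValue A η) y‖ ≤ M ∧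
      |entropicValue A η y - entropicValue A η (b x, c x)| ≤ M * ‖y - (b x, c x)‖ ∧
      ‖fderiv ℝ (entropicValue A η) y - fderiv ℝ (entropicValue A η) (b x, c x)‖ ≤
        M * ‖y - (b x, c x)‖ ∧
      |entropicValue A η y + fderiv ℝ (entropicValue A η) y ((b x, c x) - y) -
        entropicValue A η (b x, c x)| ≤ M * ‖y - (b x, c x)‖ ^ 2 := by
  obtain ⟨ε, hε, hp⟩ := hfeas
  obtain ⟨ρ, hρ, hball⟩ := exists_ball_subset_slaterSet hA hε
  obtain ⟨B, hB⟩ := exists_norm_le_of_forall_coord_le hb_bdd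
  obtain ⟨C, hC⟩ := exists_norm_le_of_forall_coord_le hc_bdd
  have hslater : ∀ x, ∀ y : E J × E K, ‖y - (b x, c x)‖ < ρ → y.1 ∈ slaterSet A := by
    intro x y hy
    refine hball (b x) (hp x) ?_
    rw [mem_ball_iff_norm]
    exact (norm_fst_le (y - (b x, c x))).trans_lt hy
  have hR : Bornology.IsBounded (Set.range fun x => (b x, c x)) := by
    refine isBounded_iff_forall_norm_le.2 ⟨max B C, ?_⟩
    rintro _ ⟨x, rfl⟩
    exact max_le_max (hB x) (hC x)
  obtain ⟨δ, hδ, M, hM, h⟩ := exists_uniform_taylor_bound (s := entropicValue A η) hR hρ (by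
    rintro _ ⟨x, rfl⟩ y hy
    exact contDiffAt_entropicValue hA hη (hslater x y (mem_ball_iff_norm.1 hy)))
  refine ⟨min δ (ρ / 2), lt_min hδ (half_pos hρ), M, hM, fun x y hy => ⟨hslater x y ?_, ?_⟩⟩
  · exact (hy.trans (min_le_right _ _)).trans_lt (half_lt_self hρ)
  · exact h _ ⟨x, rfl⟩ y (hy.trans (min_le_left _ _))

variable [MeasurableSpace 𝒳] [MeasurableSpace 𝒪] {Q : Measure 𝒪}
  {X : 𝒪 → 𝒳} {φb : 𝒪 → E J} {φc : 𝒪 → E K}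

lemma measurable_entropicValue (A : Matrix (Fin J) (Fin K) ℝ) (hη : 0 < η) :
    Measurable (entropicValue A η) :=
  measurable_snd.inner (measurable_entropicSol A hη)

lemma memLp_debiasVec {d : ℕ} {φ : Fin d → (𝒳 → ℝ) → 𝒪 → ℝ} {g : 𝒳 → E d}
    (h : ∀ j, IsDebiasing Q X (φ j) (fun x => g x j)) : MemLp (debiasVec φ g) 2 Q :=
  MemLp.of_eval_piLp fun j => (h j).1

lemma lintegral_enorm_sq_le_of_abs_le {g h : 𝒪 → ℝ} {δ : ℝ}
    (hgh : ∀ᵐ o ∂Q, |g o| ≤ δ * h o) (hh : Integrable (fun o => h o ^ 2) Q) :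
    ∫⁻ o, ‖g o‖ₑ ^ 2 ∂Q ≤ ENNReal.ofReal (δ ^ 2 * ∫ o, h o ^ 2 ∂Q) := by
  rw [← integral_const_mul, ofReal_integral_eq_lintegral_ofReal (hh.const_mul _)
      (ae_of_all _ fun o => by positivity)]
  refine lintegral_mono_ae ?_
  filter_upwards [hgh] with o ho
  rw [Real.enorm_eq_ofReal_abs, ← ENNReal.ofReal_pow (abs_nonneg _), ← mul_pow]
  exact ENNReal.ofReal_le_ofReal (pow_le_pow_left₀ (abs_nonneg _) ho 2)

variable [IsProbabilityMeasure Q]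

/-- Tower property: `f (X o) j` is measurable for the σ-algebra of `X` and pulls out of the
conditional expectation, which is zero. -/
lemma integral_inner_debiasVec_eq_zero {d : ℕ} {φ : Fin d → (𝒳 → ℝ) → 𝒪 → ℝ} {g : 𝒳 → E d}
    (hX : Measurable X) (h : ∀ j, IsDebiasing Q X (φ j) (fun x => g x j)) {f : 𝒳 → E d}
    (hf : Measurable f) {B : ℝ} (hB : ∀ x, ‖f x‖ ≤ B) :
    ∫ o, ⟪f (X o), debiasVec φ g o⟫ ∂Q = 0 := by
  have hfj : ∀ j, Measurable fun x => f x j := fun j => by fun_prop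
  have hint : ∀ j, Integrable (fun o => f (X o) j * φ j (fun x => g x j) o) Q := fun j =>
    ((h j).1.integrable (by norm_num)).bdd_mul
      ((hfj j).comp hX).aestronglyMeasurable
      (ae_of_all _ fun o => (PiLp.norm_apply_le (f (X o)) j).trans (hB (X o)))
  simp only [PiLp.inner_apply, RCLike.inner_apply, conj_trivial, debiasVec]
  rw [integral_finsetSum _ fun j _ => by simpa only [mul_comm] using hint j]
  refine Finset.sum_eq_zero fun j _ => ?_
  have hle : MeasurableSpace.comap X inferInstance ≤ (inferInstance : MeasurableSpace 𝒪) :=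
    hX.comap_le
  have hsm : StronglyMeasurable[MeasurableSpace.comap X inferInstance] fun o => f (X o) j :=
    ((hfj j).comp (comap_measurable X)).stronglyMeasurable
  have hce := condExp_mul_of_stronglyMeasurable_left (μ := Q) hsm (hint j)
    ((h j).1.integrable (by norm_num))
  simp only [mul_comm (φ j (fun x => g x j) _)]
  rw [← integral_condExp hle]
  refine integral_eq_zero_of_ae (hce.trans ?_)
  filter_upwards [(h j).2.1] with o ho
  simp [ho]

lemma abs_add_apply_sub_le {F : Type*} [SeminormedAddCommGroup F] [NormedSpace ℝ F]
    {D D' : F →L[ℝ] ℝ} {a a' M δ : ℝ} {v w : F} (hM : 0 ≤ M) (ha : |a' - a| ≤ M * δ)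
    (hD : ‖D'‖ ≤ M) (hDD : ‖D' - D‖ ≤ M * δ) (hvw : ‖v - w‖ ≤ δ) :
    |a' + D' v - (a + D w)| ≤ δ * (M * (2 + ‖w‖)) := by
  have h1 : |D' (v - w)| ≤ M * δ := (D'.le_opNorm _).trans (mul_le_mul hD hvw (norm_nonneg _) hM)
  have h2 : |(D' - D) w| ≤ M * δ * ‖w‖ :=
    ((D' - D).le_opNorm _).trans (mul_le_mul_of_nonneg_right hDD (norm_nonneg _))
  have h3 : a' + D' v - (a + D w) = (a' - a) + D' (v - w) + (D' - D) w := by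
    rw [map_sub, _root_.sub_apply]
    ring
  rw [h3]
  refine (abs_add_three _ _ _).trans ?_
  linarith

/-- Deterministic bounds for the difference between the entropic term formed with estimates and the
one formed with the true functions. -/
lemma exists_entropicTerm_remainder_bounds (hA : A.rank = J) (hη : 0 < η) (hX : Measurable X)
    (hb : Measurable b) (hc : Measurable c)
    (hb_bdd : ∃ B : ℝ, ∀ x j, |b x j| ≤ B) (hc_bdd : ∃ B : ℝ, ∀ x k, |c x k| ≤ B)
    (hfeas : ∃ ε : ℝ, 0 < ε ∧ ∀ x, ∃ p ∈ feasibleSet A (b x), ∀ k, ε ≤ p k)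
    (hφb : MemLp φb 2 Q) (hφc : MemLp φc 2 Q)
    (hφb0 : ∀ f : 𝒳 → E J, Measurable f → ∀ B : ℝ, (∀ x, ‖f x‖ ≤ B) →
      ∫ o, ⟪f (X o), φb o⟫ ∂Q = 0)
    (hφc0 : ∀ f : 𝒳 → E K, Measurable f → ∀ B : ℝ, (∀ x, ‖f x‖ ≤ B) →
      ∫ o, ⟪f (X o), φc o⟫ ∂Q = 0)
    {ψ : 𝒪 → ℝ}
    (hψ : ψ =ᵐ[Q] fun o => entropicTerm A η (b (X o)) (c (X o)) (φb o) (φc o)) :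
    MemLp ψ 2 Q ∧ ∫ o, ψ o ∂Q = entropicBound A η Q X b c ∧
    ∃ δ₀ : ℝ, 0 < δ₀ ∧ ∃ M : ℝ, 0 ≤ M ∧ ∀ δ : ℝ, δ ≤ δ₀ →
      ∀ (bh : 𝒳 → E J) (ch : 𝒳 → E K) (φbh : 𝒪 → E J) (φch : 𝒪 → E K),
      Measurable bh → Measurable ch → Measurable φbh → Measurable φch →
      (∀ x, ‖bh x - b x‖ ≤ δ) → (∀ x, ‖ch x - c x‖ ≤ δ) →
      (∀ o, ‖φbh o - φb o‖ ≤ δ) → (∀ o, ‖φch o - φc o‖ ≤ δ) →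
      ∫⁻ o, ‖entropicTerm A η (bh (X o)) (ch (X o)) (φbh o) (φch o) - ψ o‖ₑ ^ 2 ∂Q ≤
        ENNReal.ofReal (δ ^ 2 * M) ∧
      ∀ Rb Rc : ℝ, DebiasedBound Q X b bh φbh Rb → DebiasedBound Q X c ch φch Rc →
        |∫ o, (entropicTerm A η (bh (X o)) (ch (X o)) (φbh o) (φch o) - ψ o) ∂Q| ≤
          M * (∫ o, ‖bh (X o) - b (X o)‖ ^ 2 ∂Q + ∫ o, ‖ch (X o) - c (X o)‖ ^ 2 ∂Q) +
            M * Rb + M * Rc := by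
  obtain ⟨δ₀, hδ₀, M, hM, hT⟩ := exists_entropicValue_taylor_bound hA hη hb_bdd hc_bdd hfeas
  set s := entropicValue A η with hs_def
  have hs : Measurable s := measurable_entropicValue A hη
  set φ : 𝒪 → E J × E K := fun o => (φb o, φc o) with hφ_def
  have hφ : MemLp φ 2 Q := MemLp.of_fst_snd ⟨hφb, hφc⟩
  have hφ1 : Integrable φ Q := hφ.integrable (by norm_num)
  have hz : Measurable fun x => (b x, c x) := hb.prodMk hc
  have hself : ∀ x, ‖((b x, c x) : E J × E K) - (b x, c x)‖ ≤ δ₀ := fun x => by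
    simpa using hδ₀.le
  have hψ' : ψ =ᵐ[Q] fun o => s (b (X o), c (X o)) + fderiv ℝ s (b (X o), c (X o)) (φ o) := by
    filter_upwards [hψ] with o ho
    rw [ho]
    exact entropicTerm_eq hA hη (hT (X o) _ (hself _)).1 (φ o)
  have hsz : ∀ x, |s (b x, c x)| ≤ M := fun x => (hT x _ (hself x)).2.1
  have hDz : ∀ x, ‖fderiv ℝ s (b x, c x)‖ ≤ M := fun x => (hT x _ (hself x)).2.2.1
  have hψmem : MemLp ψ 2 Q := by
    refine MemLp.ae_eq hψ'.symm (MemLp.add ?_ ?_)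
    · exact MemLp.of_bound (hs.comp (hz.comp hX)).aestronglyMeasurable M
        (ae_of_all _ fun o => hsz (X o))
    · refine MemLp.of_le_mul (c := M) hφ (aestronglyMeasurable_fderiv_apply s
        (hz.comp hX) hφ.1) (ae_of_all _ fun o => ?_)
      exact ((fderiv ℝ s (b (X o), c (X o))).le_opNorm _).trans
        (mul_le_mul_of_nonneg_right (hDz _) (norm_nonneg _))
  have hψint : ∫ o, ψ o ∂Q = ∫ o, s (b (X o), c (X o)) ∂Q := by
    rw [integral_congr_ae hψ']
    exact integral_add_fderiv_eq hX hz hs hsz hDz hφ1 hφb0 hφc0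
  -- Since `φ` is unbounded, the difference of summands is small only relative to `2 + ‖φ‖`; square
  -- integrability of `φ` makes this enough in `L²`.
  set L : 𝒪 → ℝ := fun o => (M * (2 + ‖φ o‖)) ^ 2 with hL_def
  have hL : Integrable L Q := by
    have h1 : MemLp (fun o => 2 + ‖φ o‖) 2 Q := (memLp_const (2 : ℝ)).add hφ.norm
    exact (h1.const_mul M).integrable_sq
  have hL0 : 0 ≤ ∫ o, L o ∂Q := integral_nonneg fun o => sq_nonneg _
  refine ⟨hψmem, hψint, δ₀, hδ₀, max M (∫ o, L o ∂Q), hM.trans (le_max_left _ _),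
    fun δ hδ bh ch φbh φch hbh hch hφbh hφch hdb hdc hdφb hdφc => ?_⟩
  have hzh : Measurable fun x => (bh x, ch x) := hbh.prodMk hch
  have hdz : ∀ x, ‖(bh x, ch x) - (b x, c x)‖ ≤ δ := fun x => max_le (hdb x) (hdc x)
  have hTh := fun x => hT x (bh x, ch x) ((hdz x).trans hδ)
  have hterm : ∀ o, entropicTerm A η (bh (X o)) (ch (X o)) (φbh o) (φch o) =
      s (bh (X o), ch (X o)) + fderiv ℝ s (bh (X o), ch (X o)) (φbh o, φch o) := fun o =>
    entropicTerm_eq hA hη (hTh (X o)).1 (φbh o, φch o)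
  simp only [hterm]
  constructor
  · refine (lintegral_enorm_sq_le_of_abs_le (δ := δ) (h := fun o => M * (2 + ‖φ o‖)) ?_
      hL).trans (ENNReal.ofReal_le_ofReal
        (mul_le_mul_of_nonneg_left (le_max_right _ _) (sq_nonneg _)))
    filter_upwards [hψ'] with o ho
    obtain ⟨-, -, h1, h2, h3, -⟩ := hTh (X o)
    have hd := mul_le_mul_of_nonneg_left (hdz (X o)) hM
    rw [ho]
    exact abs_add_apply_sub_le hM (h2.trans hd) h1 (h3.trans hd) (max_le (hdφb o) (hdφc o))
  · intro Rb Rc hRb hRc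
    have hnonempty : Nonempty 𝒳 := by
      obtain ⟨o⟩ := Q.nonempty_of_neZero
      exact ⟨X o⟩
    have hφbh1 : Integrable φbh Q := by
      have h1 : Integrable (fun o => φbh o - φb o) Q := Integrable.of_bound
        (hφbh.aestronglyMeasurable.sub hφb.1) δ (ae_of_all _ hdφb)
      refine (h1.add (hφb.integrable (by norm_num))).congr (ae_of_all _ fun o => ?_)
      simp
    have hφch1 : Integrable φch Q := by
      have h1 : Integrable (fun o => φch o - φc o) Q := Integrable.of_bound
        (hφch.aestronglyMeasurable.sub hφc.1) δ (ae_of_all _ hdφc)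
      refine (h1.add (hφc.integrable (by norm_num))).congr (ae_of_all _ fun o => ?_)
      simp
    -- Testing with `f = 0` and the bound `1` shows that any admissible rate is nonnegative, so `M`
    -- may be enlarged.
    have hR0 : ∀ {d : ℕ} {g gh : 𝒳 → E d} {φh : 𝒪 → E d} {R : ℝ},
        DebiasedBound Q X g gh φh R → 0 ≤ R := by
      intro d g gh φh R hR
      have h1 := hR 0 measurable_zero 1 fun x => by simp
      simpa using h1
    have hmain := abs_integral_plugin_sub_le hX hs hb hbh hc hch hφbh1 hφch1 hM hdz hsz
      (fun x => (hTh x).2.1) (fun x => (hTh x).2.2.1) (fun x => (hTh x).2.2.2.2.2) hRb hRc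
    have hint : Integrable (fun o => s (bh (X o), ch (X o)) +
        fderiv ℝ s (bh (X o), ch (X o)) (φbh o, φch o)) Q :=
      (integrable_comp_of_bound hX hzh hs fun x => (hTh x).2.1).add
        (integrable_fderiv_apply hX hzh (fun x => (hTh x).2.2.1) (hφbh1.prodMk hφch1))
    rw [integral_sub hint (hψmem.integrable (by norm_num)), hψint]
    refine hmain.trans ?_
    have hle : M ≤ max M (∫ o, L o ∂Q) := le_max_left _ _
    have h1 := hR0 hRb
    have h2 := hR0 hRc
    gcongr

end EntropicRemainder

/-! ### Combining events, and the oracle central limit theorem -/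

section Limit

variable {Ω : Type*} [MeasurableSpace Ω] {P : Measure Ω}

lemma tendsto_measure_not_and {p q : ℕ → Ω → Prop}
    (hp : Tendsto (fun n => P {ω | ¬ p n ω}) atTop (𝓝 0))
    (hq : Tendsto (fun n => P {ω | ¬ q n ω}) atTop (𝓝 0)) :
    Tendsto (fun n => P {ω | ¬ (p n ω ∧ q n ω)}) atTop (𝓝 0) := by
  refine tendsto_of_tendsto_of_tendsto_of_le_of_le tendsto_const_nhds
    (by simpa using hp.add hq) (fun _ => zero_le)
    fun n => (measure_mono fun ω hω => ?_).trans (measure_union_le _ _)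
  simp only [Set.mem_ofPred_eq, Set.mem_union, not_and_or] at hω ⊢
  exact hω

lemma tendsto_measure_not_mono {p q : ℕ → Ω → Prop}
    (hp : Tendsto (fun n => P {ω | ¬ p n ω}) atTop (𝓝 0)) (hpq : ∀ᶠ n in atTop, ∀ ω, p n ω → q n ω) :
    Tendsto (fun n => P {ω | ¬ q n ω}) atTop (𝓝 0) := by
  refine tendsto_of_tendsto_of_tendsto_of_le_of_le' tendsto_const_nhds hp
    (Eventually.of_forall fun _ => zero_le) ?_
  filter_upwards [hpq] with n hn
  refine measure_mono fun ω hω => ?_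
  simp only [Set.mem_ofPred_eq] at hω ⊢
  exact fun h => hω (hn ω h)

lemma tendstoInDistribution_sqrt_mul_average_sub {𝒪 : Type*} [MeasurableSpace 𝒪] {Q : Measure 𝒪}
    [IsProbabilityMeasure P] [IsProbabilityMeasure Q] {O : ℕ → Ω → 𝒪} (hO_law : ∀ i, HasLaw (O i) Q P)
    (hO_indep : iIndepFun O P) {ψ : 𝒪 → ℝ} (hψ : Measurable ψ) (hψ2 : MemLp ψ 2 Q) {θ V : ℝ}
    (hθ : ∫ o, ψ o ∂Q = θ) (hV : Var[ψ; Q] = V) (hV_pos : 0 < V) :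
    TendstoInDistribution
      (fun (n : ℕ) ω => (√n)⁻¹ * ∑ i ∈ Finset.range n, (ψ (O i ω) - θ) / √V)
      atTop (id : ℝ → ℝ) (fun _ => P) (gaussianReal 0 1) := by
  have hg : Measurable fun o => (ψ o - θ) / √V := (hψ.sub_const θ).div_const _
  have hcomp : ∀ {g : 𝒪 → ℝ}, Measurable g → ∀ i, ∫ ω, g (O i ω) ∂P = ∫ o, g o ∂Q := by
    intro g hg i
    rw [← (hO_law i).map_eq, integral_map (hO_law i).aemeasurable hg.aestronglyMeasurable]
  refine tendstoInDistribution_inv_sqrt_mul_sum (X := fun i ω => (ψ (O i ω) - θ) / √V)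
    ⟨aemeasurable_id, Measure.map_id⟩ ?_ ?_ (hO_indep.comp (fun _ o => (ψ o - θ) / √V) fun _ => hg)
    fun i => ?_
  · rw [hcomp hg 0, integral_div, integral_sub (hψ2.integrable (by norm_num)) (by simp), hθ]
    simp
  · simp only [Pi.pow_apply, div_pow]
    rw [hcomp (g := fun o => (ψ o - θ) ^ 2 / √V ^ 2) (by fun_prop) 0, integral_div, ← hθ,
      ← variance_eq_integral hψ.aemeasurable, Real.sq_sqrt hV_pos.le, hV, div_self hV_pos.ne']
  · refine IdentDistrib.comp (u := fun o => (ψ o - θ) / √V) ?_ hg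
    exact ⟨(hO_law i).aemeasurable, (hO_law 0).aemeasurable,
      (hO_law i).map_eq.trans (hO_law 0).map_eq.symm⟩

lemma aemeasurable_sum_apply_apply {𝒪 𝒲 : Type*} [MeasurableSpace 𝒪] [MeasurableSpace 𝒲]
    {D : 𝒲 → 𝒪 → ℝ} (hD : Measurable (Function.uncurry D)) {W : Ω → 𝒲} (hW : AEMeasurable W P)
    {O : ℕ → Ω → 𝒪} (hO : ∀ i, AEMeasurable (O i) P) (n : ℕ) :
    AEMeasurable (fun ω => ∑ i ∈ Finset.range n, D (W ω) (O i ω)) P := by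
  refine Finset.aemeasurable_fun_sum _ fun i _ => ?_
  have hWO : AEMeasurable (fun ω => (W ω, O i ω)) P := hW.prodMk (hO i)
  exact hD.comp_aemeasurable hWO

end Limit

end CondLP

theorem mainTheorem4
    {Ω 𝒳 𝒪 : Type*} [MeasurableSpace Ω] [MeasurableSpace 𝒳] [MeasurableSpace 𝒪]
    (P : Measure Ω) [IsProbabilityMeasure P]
    -- the law `Q` of an observation `O`, and its covariate part `X`
    (Q : Measure 𝒪) [IsProbabilityMeasure Q] (X : 𝒪 → 𝒳) (hX : Measurable X)
    -- the conditional linear program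
    {J K : ℕ} (A : Matrix (Fin J) (Fin K) ℝ) (hA : A.rank = J)
    (b : 𝒳 → CondLP.E J) (hb : Measurable b) (hb_bdd : ∃ B : ℝ, ∀ x j, |b x j| ≤ B)
    (c : 𝒳 → CondLP.E K) (hc : Measurable c) (hc_bdd : ∃ B : ℝ, ∀ x k, |c x k| ≤ B)
    (hfeas_bdd : ∀ x, Bornology.IsBounded (CondLP.feasibleSet A (b x)))
    (hfeas : ∃ ε : ℝ, 0 < ε ∧ ∀ x, ∃ p ∈ CondLP.feasibleSet A (b x), ∀ k, ε ≤ p k)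
    (η : ℝ) (hη : 0 < η)
    -- the de-biasing functions
    (φb : Fin J → (𝒳 → ℝ) → 𝒪 → ℝ)
    (hφb : ∀ j, CondLP.IsDebiasing Q X (φb j) (fun x => b x j))
    (φc : Fin K → (𝒳 → ℝ) → 𝒪 → ℝ)
    (hφc : ∀ k, CondLP.IsDebiasing Q X (φc k) (fun x => c x k))
    -- the iid sample and, for each `n`, an independent training sample
    (O : ℕ → Ω → 𝒪) (hO_law : ∀ i, HasLaw (O i) Q P) (hO_indep : iIndepFun O P)
    {𝒲 : ℕ → Type*} [∀ n, MeasurableSpace (𝒲 n)]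
    (W : ∀ n, Ω → 𝒲 n) (hW : ∀ n, Measurable (W n))
    (hW_indep : ∀ n, IndepFun (W n) (fun ω (i : Fin n) => O i ω) P)
    -- the estimates, fit on the training sample
    (bhat : ∀ n, 𝒲 n → 𝒳 → CondLP.E J) (hbhat : ∀ n, Measurable (Function.uncurry (bhat n)))
    (chat : ∀ n, 𝒲 n → 𝒳 → CondLP.E K) (hchat : ∀ n, Measurable (Function.uncurry (chat n)))
    (φbhat : ∀ n, 𝒲 n → 𝒪 → CondLP.E J)
    (hφbhat : ∀ n, Measurable (Function.uncurry (φbhat n)))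
    (φchat : ∀ n, 𝒲 n → 𝒪 → CondLP.E K)
    (hφchat : ∀ n, Measurable (Function.uncurry (φchat n)))
    -- consistency and the de-biased rate
    (r : ℕ → ℝ)
    (hrate_b : CondLP.EstimationRates P Q X W b (CondLP.debiasVec φb b) bhat φbhat r)
    (hrate_c : CondLP.EstimationRates P Q X W c (CondLP.debiasVec φc c) chat φchat r)
    -- the conditions of the corollary
    (hb_L2 : CondLP.IsLittleOp P
      (fun n ω => eLpNorm (fun o => bhat n (W n ω) (X o) - b (X o)) 2 Q)
      (fun n => (n : ℝ) ^ (-(1 / 4) : ℝ)))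
    (hc_L2 : CondLP.IsLittleOp P
      (fun n ω => eLpNorm (fun o => chat n (W n ω) (X o) - c (X o)) 2 Q)
      (fun n => (n : ℝ) ^ (-(1 / 4) : ℝ)))
    (hr : r =o[atTop] fun n => (n : ℝ) ^ (-(1 / 2) : ℝ))
    -- the asymptotic variance
    (V : ℝ)
    (hV : V = Var[fun o => CondLP.entropicTerm A η (b (X o)) (c (X o))
      (CondLP.debiasVec φb b o) (CondLP.debiasVec φc c o); Q])
    (hV_pos : 0 < V) :
    TendstoInDistribution
      (fun (n : ℕ) (ω : Ω) =>
        √(n : ℝ) *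
          (CondLP.entropicAverage A η X (bhat n (W n ω)) (chat n (W n ω))
              (φbhat n (W n ω)) (φchat n (W n ω)) n (fun i => O i ω)
            - CondLP.entropicBound A η Q X b c) / √V)
      atTop (id : ℝ → ℝ) (fun _ => P) (gaussianReal 0 1) := by
  have hnonempty : Nonempty 𝒳 := by
    obtain ⟨o⟩ := Q.nonempty_of_neZero
    exact ⟨X o⟩
  set φb' := CondLP.debiasVec φb b
  set φc' := CondLP.debiasVec φc c
  have hφb' : MemLp φb' 2 Q := CondLP.memLp_debiasVec hφb
  have hφc' : MemLp φc' 2 Q := CondLP.memLp_debiasVec hφc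
  have hterm := CondLP.measurable_entropicTerm hA hη
  have hv : AEMeasurable (fun o => ((b (X o), c (X o)), (φb' o, φc' o))) Q :=
    ((hb.comp hX).prodMk (hc.comp hX)).aemeasurable.prodMk
      (hφb'.1.aemeasurable.prodMk hφc'.1.aemeasurable)
  have hψ_aem := hterm.comp_aemeasurable hv
  -- The de-biasing functions are only almost everywhere measurable, so the true summand is replaced
  -- by a measurable version.
  obtain ⟨ψ, hψ_meas, hψ_ae⟩ := hψ_aem
  obtain ⟨hψ_mem, hψ_int, δ₀, hδ₀, M, hM, hbounds⟩ :=
    CondLP.exists_entropicTerm_remainder_bounds hA hη hX hb hc hb_bdd hc_bdd hfeas hφb' hφc'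
      (fun f hf B hB => CondLP.integral_inner_debiasVec_eq_zero hX hφb hf hB)
      (fun f hf B hB => CondLP.integral_inner_debiasVec_eq_zero hX hφc hf hB) hψ_ae.symm
  have hψ_var : Var[ψ; Q] = V := by
    rw [hV]
    exact variance_congr hψ_ae.symm
  set θ := CondLP.entropicBound A η Q X b c
  let D : ∀ n, 𝒲 n → 𝒪 → ℝ := fun n w o =>
    CondLP.entropicTerm A η (bhat n w (X o)) (chat n w (X o)) (φbhat n w o) (φchat n w o) - ψ o
  have hD : ∀ n, Measurable (Function.uncurry (D n)) := fun n => by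
    have hX' : Measurable fun z : 𝒲 n × 𝒪 => (z.1, X z.2) :=
      measurable_fst.prodMk (hX.comp measurable_snd)
    have hest : Measurable fun z : 𝒲 n × 𝒪 => ((bhat n z.1 (X z.2), chat n z.1 (X z.2)),
        (φbhat n z.1 z.2, φchat n z.1 z.2)) :=
      (((hbhat n).comp hX').prodMk ((hchat n).comp hX')).prodMk ((hφbhat n).prodMk (hφchat n))
    exact (hterm.comp hest).sub (hψ_meas.comp measurable_snd)
  have hgood : ∀ ε : ℝ, 0 < ε → Tendsto (fun n => P {ω | ¬ (
      ∫⁻ o, ‖D n (W n ω) o‖ₑ ^ 2 ∂Q ≤ ENNReal.ofReal ε ∧ √n * |∫ o, D n (W n ω) o ∂Q| ≤ ε)})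
      atTop (𝓝 0) := by
    intro ε hε
    obtain ⟨δ, hδ, hδδ₀, hδε⟩ : ∃ δ : ℝ, 0 < δ ∧ δ ≤ δ₀ ∧ δ ^ 2 * M ≤ ε := by
      have hpos : 0 < ε / (M + 1) := by positivity
      refine ⟨min δ₀ √(ε / (M + 1)), lt_min hδ₀ (Real.sqrt_pos.2 hpos), min_le_left _ _, ?_⟩
      calc min δ₀ √(ε / (M + 1)) ^ 2 * M ≤ √(ε / (M + 1)) ^ 2 * (M + 1) := by
            gcongr
            · exact min_le_right _ _
            · linarith
        _ = ε := by
          rw [Real.sq_sqrt hpos.le]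
          field_simp
    -- Four contributions, two squared `L²` errors and two de-biased rates, each at most `M` times
    -- this number after scaling by `√n`.
    have hκ : 0 < ε / (4 * (M + 1)) := by positivity
    have hbX : ∀ n ω, AEStronglyMeasurable (fun o => bhat n (W n ω) (X o) - b (X o)) Q :=
      fun n ω => ((((hbhat n).comp measurable_prodMk_left).sub hb).comp hX).aestronglyMeasurable
    have hcX : ∀ n ω, AEStronglyMeasurable (fun o => chat n (W n ω) (X o) - c (X o)) Q :=
      fun n ω => ((((hchat n).comp measurable_prodMk_left).sub hc).comp hX).aestronglyMeasurable
    have hev := CondLP.tendsto_measure_not_and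
      (CondLP.tendsto_measure_not_and
        (CondLP.tendsto_measure_not_and
          (CondLP.tendsto_measure_not_forall_norm_le
            (Z := fun n ω x => bhat n (W n ω) x - b x) hrate_b.1 hδ)
          (CondLP.tendsto_measure_not_forall_norm_le
            (Z := fun n ω x => chat n (W n ω) x - c x) hrate_c.1 hδ))
        (CondLP.tendsto_measure_not_and
          (CondLP.tendsto_measure_not_forall_norm_le
            (Z := fun n ω o => φbhat n (W n ω) o - φb' o) hrate_b.2.1 hδ)
          (CondLP.tendsto_measure_not_forall_norm_le
            (Z := fun n ω o => φchat n (W n ω) o - φc' o) hrate_c.2.1 hδ)))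
      (CondLP.tendsto_measure_not_and
        (CondLP.tendsto_measure_not_and
          (CondLP.tendsto_measure_not_sqrt_mul_integral_sq_le hbX hb_L2 hκ)
          (CondLP.tendsto_measure_not_sqrt_mul_integral_sq_le hcX hc_L2 hκ))
        (CondLP.tendsto_measure_not_and
          (CondLP.tendsto_measure_not_debiasedBound hrate_b.2.2 hr hκ)
          (CondLP.tendsto_measure_not_debiasedBound hrate_c.2.2 hr hκ)))
    refine CondLP.tendsto_measure_not_mono hev ?_
    filter_upwards [eventually_gt_atTop 0] with n hn ω
    rintro ⟨⟨⟨h1, h2⟩, h3, h4⟩, ⟨h5, h6⟩, h7, h8⟩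
    obtain ⟨h9, h10⟩ := hbounds δ hδδ₀ _ _ _ _ ((hbhat n).comp measurable_prodMk_left)
      ((hchat n).comp measurable_prodMk_left) ((hφbhat n).comp measurable_prodMk_left)
      ((hφchat n).comp measurable_prodMk_left) h1 h2 h3 h4
    refine ⟨h9.trans (ENNReal.ofReal_le_ofReal hδε), ?_⟩
    have hn' : (0 : ℝ) < √(n : ℝ) := Real.sqrt_pos.2 (by exact_mod_cast hn)
    have h11 := mul_le_mul_of_nonneg_left (h10 _ _ h7 h8) hn'.le
    refine h11.trans ?_
    set Ib := ∫ o, ‖bhat n (W n ω) (X o) - b (X o)‖ ^ 2 ∂Q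
    set Ic := ∫ o, ‖chat n (W n ω) (X o) - c (X o)‖ ^ 2 ∂Q
    set κ := ε / (4 * (M + 1)) with hκ_def
    calc √(n : ℝ) * (M * (Ib + Ic) + M * (κ / √n) + M * (κ / √n))
        = M * (√n * Ib + √n * Ic + κ + κ) := by
          field_simp
      _ ≤ M * (κ + κ + κ + κ) := by gcongr
      _ ≤ (M + 1) * (κ + κ + κ + κ) := by
          gcongr
          linarith
      _ = ε := by
        rw [hκ_def]
        field_simp
        ring
  have hrem := CondLP.tendstoInMeasure_inv_sqrt_mul_sum hO_law hO_indep hW hW_indep hD hgood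
  have hsV : 0 < √V := Real.sqrt_pos.2 hV_pos
  have hrem' : TendstoInMeasure P (fun (n : ℕ) ω =>
      ((√n)⁻¹ * ∑ i ∈ Finset.range n, D n (W n ω) (O i ω)) / √V) atTop (fun _ => 0) := by
    rw [tendstoInMeasure_iff_norm] at hrem ⊢
    intro κ hκ
    have h := hrem (κ * √V) (by positivity)
    simpa only [sub_zero, norm_div, Real.norm_of_nonneg hsV.le, le_div_iff₀ hsV] using h
  have hmeas : ∀ n : ℕ, AEMeasurable (fun ω =>
      ((√n)⁻¹ * ∑ i ∈ Finset.range n, D n (W n ω) (O i ω)) / √V) P := fun n =>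
    ((CondLP.aemeasurable_sum_apply_apply (hD n) (hW n).aemeasurable
      (fun i => (hO_law i).aemeasurable) n).const_mul _).div_const _
  have hclt := CondLP.tendstoInDistribution_sqrt_mul_average_sub hO_law hO_indep hψ_meas hψ_mem
    hψ_int hψ_var hV_pos
  -- Slutsky; what remains is the algebraic identity splitting the estimator into oracle sum and
  -- remainder, with `n = 0` treated apart because of the division by `√n`.
  refine (hclt.add_of_tendstoInMeasure_const hrem' hmeas).congr (fun n => ae_of_all _ fun ω => ?_)
    (ae_of_all _ fun x => add_zero x)
  simp only [Pi.add_apply, D, CondLP.entropicAverage]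
  rw [← Finset.sum_div, Finset.sum_sub_distrib, Finset.sum_sub_distrib]
  rcases Nat.eq_zero_or_pos n with rfl | hn
  · simp
  have hn' : (0 : ℝ) < n := by exact_mod_cast hn
  have hsq : √(n : ℝ) * √n = n := Real.mul_self_sqrt hn'.le
  have hsn : 0 < √(n : ℝ) := Real.sqrt_pos.2 hn'
  rw [← hsq]
  field_simp
  simp
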